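/- Fix an integer $d\ge 1$. An instance consists of integers $t\ge 1$, $k\ge 2$ and real polynomials $l_1,r_1,\dots,l_t,r_t$ of degree at most $d$, given by their coefficients, such that on $\lambda>0$ every $l_i$ is nondecreasing and every $r_i$ is nonincreasing, and for every $\lambda>0$ the closed intervals $I_i(\lambda)=[l_i(\lambda),r_i(\lambda)]$ (empty if $r_i(\lambda)<l_i(\lambda)$) are pairwise disjoint and sorted from left to right. Call $\lambda>0$ feasible if there are $k$ points in $\bigcup_{i=1}^t I_i(\lambda)$ whose pairwise distances are all at least $\lambda$, and suppose that some $\lambda>0$ is feasible. Then the maximum feasible $\lambda$ exists, and the problem of finding it can be solved in $$O\bigl(t^2\log k+t\log k\,\log(t^2+k)\bigr)$$ time. That is, there are a program and a constant $C$, both depending only on $d$, such that on every such instance the program outputs the maximum feasible $\lambda$ after at most $C\,(t^2\log k+t\log k\log(t^2+k))$ steps. The machine is a real RAM without floor function: at unit cost it performs arithmetic and comparisons on real numbers; addition, truncated subtraction, halving (rounded down) and comparisons on natural numbers; conversion of a natural number to a real; array access; and the extraction of the largest real root of a real polynomial of degree at most $d$ given by its coefficients. -/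

import Mathlib

open Polynomial

namespace RealRAM

/-- Memory of a real random access machine: natural-number registers, real registers, and arrays of
natural numbers and of reals. Registers and arrays are named by natural numbers; a program mentions
only finitely many names, while array cells are addressed by the content of a register. -/
structure State where
  nat : ℕ → ℕ
  real : ℕ → ℝ
  natArr : ℕ → ℕ → ℕ
  realArr : ℕ → ℕ → ℝ

/-- The elementary operations. The first argument (`x` or the array `A`) is the target. There is no
floor function and no other way to turn a real into a natural number. -/
inductive Op where
  | natConst (x c : ℕ)
  | natAdd (x y z : ℕ)
  | natSub (x y z : ℕ)
  | natHalf (x y : ℕ)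
  | natLoad (x A i : ℕ)
  | natStore (A i y : ℕ)
  | realCast (x y : ℕ)
  | realAdd (x y z : ℕ)
  | realSub (x y z : ℕ)
  | realMul (x y z : ℕ)
  | realDiv (x y z : ℕ)
  | realLoad (x A i : ℕ)
  | realStore (A i y : ℕ)
  | realRoot (x y : ℕ)

/-- The largest real root of `a 0 + a 1 * X + ... + a d * X ^ d`; it is `0` if there is no real root
or if all coefficients vanish (suprema of empty and of unbounded sets of reals are `0`). -/
noncomputable def largestRoot (d : ℕ) (a : ℕ → ℝ) : ℝ :=
  sSup {x : ℝ | ∑ e ∈ Finset.range (d + 1), a e * x ^ e = 0}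

namespace State

def setNat (s : State) (x v : ℕ) : State := { s with nat := Function.update s.nat x v }

def setReal (s : State) (x : ℕ) (v : ℝ) : State := { s with real := Function.update s.real x v }

def setNatArr (s : State) (A i v : ℕ) : State :=
  { s with natArr := Function.update s.natArr A (Function.update (s.natArr A) i v) }

def setRealArr (s : State) (A i : ℕ) (v : ℝ) : State :=
  { s with realArr := Function.update s.realArr A (Function.update (s.realArr A) i v) }

end State

/-- Effect of an elementary operation on a machine that extracts roots of degree at most `d`.
The coefficients of the polynomial for `realRoot x y` are in the real registers `y, ..., y + d`. -/
noncomputable def Op.step (d : ℕ) (s : State) : Op → State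
  | natConst x c => s.setNat x c
  | natAdd x y z => s.setNat x (s.nat y + s.nat z)
  | natSub x y z => s.setNat x (s.nat y - s.nat z)
  | natHalf x y => s.setNat x (s.nat y / 2)
  | natLoad x A i => s.setNat x (s.natArr A (s.nat i))
  | natStore A i y => s.setNatArr A (s.nat i) (s.nat y)
  | realCast x y => s.setReal x (s.nat y : ℝ)
  | realAdd x y z => s.setReal x (s.real y + s.real z)
  | realSub x y z => s.setReal x (s.real y - s.real z)
  | realMul x y z => s.setReal x (s.real y * s.real z)
  | realDiv x y z => s.setReal x (s.real y / s.real z)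
  | realLoad x A i => s.setReal x (s.realArr A (s.nat i))
  | realStore A i y => s.setRealArr A (s.nat i) (s.real y)
  | realRoot x y => s.setReal x (largestRoot d fun e => s.real (y + e))

/-- Comparison of two natural-number registers or of two real registers. -/
inductive Test where
  | natLt (x y : ℕ)
  | realLt (x y : ℕ)

def Test.Holds (s : State) : Test → Prop
  | natLt x y => s.nat x < s.nat y
  | realLt x y => s.real x < s.real y

/-- Programs: finite texts, built from operations by composition, branching and while-loops. -/
inductive Prog where
  | skip
  | op (o : Op)
  | seq (p q : Prog)
  | cond (b : Test) (p q : Prog)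
  | loop (b : Test) (p : Prog)

/-- `Exec d p s s' T`: started in `s`, the program `p` halts in `s'` after `T` steps. Every elementary
operation and every evaluation of a test is one step. -/
inductive Exec (d : ℕ) : Prog → State → State → ℕ → Prop where
  | skip (s : State) : Exec d .skip s s 1
  | op (o : Op) (s : State) : Exec d (.op o) s (o.step d s) 1
  | seq {p q : Prog} {s₁ s₂ s₃ : State} {m n : ℕ} :
      Exec d p s₁ s₂ m → Exec d q s₂ s₃ n → Exec d (.seq p q) s₁ s₃ (m + n)
  | condTrue {b : Test} {p q : Prog} {s s' : State} {n : ℕ} :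
      b.Holds s → Exec d p s s' n → Exec d (.cond b p q) s s' (n + 1)
  | condFalse {b : Test} {p q : Prog} {s s' : State} {n : ℕ} :
      ¬ b.Holds s → Exec d q s s' n → Exec d (.cond b p q) s s' (n + 1)
  | loopTrue {b : Test} {p : Prog} {s₁ s₂ s₃ : State} {m n : ℕ} :
      b.Holds s₁ → Exec d p s₁ s₂ m → Exec d (.loop b p) s₂ s₃ n →
      Exec d (.loop b p) s₁ s₃ (m + n + 1)
  | loopFalse {b : Test} {p : Prog} {s : State} :
      ¬ b.Holds s → Exec d (.loop b p) s s 1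

end RealRAM

namespace Spacing

/-- The `i`-th interval `[l i (lam), r i (lam)]` at parameter `lam`; it is empty if
`r i (lam) < l i (lam)`. -/
def interval {t : ℕ} (l r : Fin t → ℝ[X]) (lam : ℝ) (i : Fin t) : Set ℝ :=
  Set.Icc ((l i).eval lam) ((r i).eval lam)

/-- At every parameter `lam > 0` the intervals are pairwise disjoint and listed from left to right. -/
def SortedDisjoint {t : ℕ} (l r : Fin t → ℝ[X]) : Prop :=
  ∀ lam : ℝ, 0 < lam → ∀ i j : Fin t, i < j →
    ∀ x ∈ interval l r lam i, ∀ y ∈ interval l r lam j, x < y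

/-- The intervals do not grow with the parameter: left endpoints are nondecreasing and right endpoints
are nonincreasing functions of `lam > 0`. -/
def Shrinking {t : ℕ} (l r : Fin t → ℝ[X]) : Prop :=
  ∀ i : Fin t, MonotoneOn (fun lam => (l i).eval lam) (Set.Ioi (0 : ℝ)) ∧
    AntitoneOn (fun lam => (r i).eval lam) (Set.Ioi (0 : ℝ))

/-- `k` nodes can be placed on the intervals at parameter `lam` so that any two of them are at distance
at least `lam`. -/
def Placeable {t : ℕ} (l r : Fin t → ℝ[X]) (k : ℕ) (lam : ℝ) : Prop :=
  ∃ x : Fin k → ℝ, (∀ a, ∃ i, x a ∈ interval l r lam i) ∧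
    ∀ a b, a ≠ b → lam ≤ dist (x a) (x b)

/-- The positive parameters at which `k` nodes can be placed. -/
def feasible {t : ℕ} (l r : Fin t → ℝ[X]) (k : ℕ) : Set ℝ :=
  {lam | 0 < lam ∧ Placeable l r k lam}

/-- The input: `t` and `k` in the natural-number registers `0` and `1`; the coefficient of `X ^ e` of
`l i` and of `r i`, for `e ≤ d`, in cell `i` of the real arrays `e` and `d + 1 + e`; all the rest of
the memory is `0`. -/
noncomputable def input (d : ℕ) {t : ℕ} (l r : Fin t → ℝ[X]) (k : ℕ) : RealRAM.State where
  nat x := if x = 0 then t else if x = 1 then k else 0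
  real _ := 0
  natArr _ _ := 0
  realArr A i :=
    if h : i < t then
      if A ≤ d then (l ⟨i, h⟩).coeff A
      else if A ≤ 2 * d + 1 then (r ⟨i, h⟩).coeff (A - (d + 1)) else 0
    else 0

end Spacing

/-! Shrinking makes the feasible set downward closed and a compactness argument makes it attain its
maximum, so it is `(0, M]` (`exists_feasible_eq`). For a fixed parameter, greedy placement from left
to right decides feasibility: in each interval a binary search finds how many points fit, which
takes time `O(t log k)` (`wp_greedyCount`).

To find `M`, the greedy placement is run with a symbolic parameter, known only to satisfy `lo ≤ M <
hi`. Points are pushed in blocks, and each block records its interval `a` and the index `m` of its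
first point. The earliest position of point `n` is then the maximum of `l a + (n - m) * lam` over
the records. Whether a block fits is a conjunction of polynomial inequalities whose difference is
antitone in `lam`, so the answer changes at one threshold, the minimum of largest roots (`wp_lower`,
`wp_fitBound`). Deciding the threshold answers the question for parameters near `M` and tightens the
bracket. If the threshold is infeasible, the block fits on all of `(0, hi]` for the new `hi`;
otherwise it fails at every parameter above the new `lo`. When all intervals are exhausted, `lo < M`
would contradict the feasibility of `M` (`Greedy.eq_of_done`).

Only `O(t)` blocks may be used. Hence numbers `c i` are computed beforehand such that a block of `c
i + 1` points is sure to fit in interval `i` whenever `c i ≠ 0` (`exists_room_above`,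
`Greedy.lt_of_jump`), while `∑ c i` falls short of `k` by at most about `5 * t` (`Chain.mul_le_sum`,
`pushes_le`). This leaves `O(t)` attempts, each with `O(t)` root extractions and one decision, hence
`O(t² log k)` steps in total. -/

namespace RealRAM

-- Weakest preconditions with a clock.

infixr:60 " ⨟ " => Prog.seq

/-- Started in `s` with `T` steps already elapsed, `p` halts in a state and at a time satisfying `Q`. -/
def wp (d : ℕ) (p : Prog) (Q : State → ℕ → Prop) (s : State) (T : ℕ) : Prop :=
  ∃ s' n, Exec d p s s' n ∧ Q s' (T + n)

section wp

variable {d : ℕ} {p q : Prog} {Q : State → ℕ → Prop} {s : State} {T : ℕ}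

theorem wp_skip (h : Q s (T + 1)) : wp d .skip Q s T := ⟨s, 1, .skip s, h⟩

theorem wp_op {o : Op} (h : Q (o.step d s) (T + 1)) : wp d (.op o) Q s T :=
  ⟨_, 1, .op o s, h⟩

theorem wp_seq (h : wp d p (wp d q Q) s T) : wp d (p ⨟ q) Q s T := by
  obtain ⟨s₁, m, h₁, s₂, n, h₂, h₃⟩ := h
  exact ⟨s₂, m + n, h₁.seq h₂, by rwa [← add_assoc]⟩

theorem wp_op_seq {o : Op} (h : wp d q Q (o.step d s) (T + 1)) : wp d (.op o ⨟ q) Q s T :=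
  wp_seq (wp_op h)

theorem wp_cond {b : Test} (h₁ : b.Holds s → wp d p Q s (T + 1))
    (h₂ : ¬ b.Holds s → wp d q Q s (T + 1)) : wp d (.cond b p q) Q s T := by
  by_cases hb : b.Holds s
  · obtain ⟨s', n, h, hq⟩ := h₁ hb
    exact ⟨s', n + 1, h.condTrue hb, by rwa [add_assoc, add_comm 1 n] at hq⟩
  · obtain ⟨s', n, h, hq⟩ := h₂ hb
    exact ⟨s', n + 1, h.condFalse hb, by rwa [add_assoc, add_comm 1 n] at hq⟩

theorem wp_mono {Q' : State → ℕ → Prop} (h : wp d p Q s T) (hQ : ∀ s T, Q s T → Q' s T) :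
    wp d p Q' s T := by
  obtain ⟨s', n, h, hq⟩ := h
  exact ⟨s', n, h, hQ _ _ hq⟩

/-- The measure `μ` only ensures termination. Running times are proved through the invariant, which
sees the elapsed time. -/
theorem wp_loop {b : Test} (I : State → ℕ → Prop) (μ : State → ℕ) (h₀ : I s T)
    (hstep : ∀ s T, I s T → b.Holds s →
      wp d p (fun s' T' => I s' T' ∧ μ s' < μ s) s (T + 1))
    (hexit : ∀ s T, I s T → ¬ b.Holds s → Q s (T + 1)) : wp d (.loop b p) Q s T := by
  induction hm : μ s using Nat.strong_induction_on generalizing s T with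
  | _ m ih =>
    by_cases hb : b.Holds s
    · obtain ⟨s₁, n₁, e₁, hI, hlt⟩ := hstep s T h₀ hb
      obtain ⟨s₂, n₂, e₂, hQ⟩ := ih _ (hm ▸ hlt) hI rfl
      exact ⟨s₂, n₁ + n₂ + 1, .loopTrue hb e₁ e₂, by convert hQ using 1; omega⟩
    · exact ⟨s, 1, .loopFalse hb, hexit s T h₀ hb⟩

end wp

namespace State

variable (s : State) (x y i j v w A B : ℕ) (a : ℝ)

@[simp] theorem nat_setNat : (s.setNat x v).nat y = if y = x then v else s.nat y :=
  Function.update_apply ..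
@[simp] theorem real_setNat : (s.setNat x v).real = s.real := rfl
@[simp] theorem natArr_setNat : (s.setNat x v).natArr = s.natArr := rfl
@[simp] theorem realArr_setNat : (s.setNat x v).realArr = s.realArr := rfl

@[simp] theorem nat_setReal : (s.setReal x a).nat = s.nat := rfl
@[simp] theorem real_setReal : (s.setReal x a).real y = if y = x then a else s.real y :=
  Function.update_apply ..
@[simp] theorem natArr_setReal : (s.setReal x a).natArr = s.natArr := rfl
@[simp] theorem realArr_setReal : (s.setReal x a).realArr = s.realArr := rfl

@[simp] theorem nat_setNatArr : (s.setNatArr A i v).nat = s.nat := rfl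
@[simp] theorem real_setNatArr : (s.setNatArr A i v).real = s.real := rfl
@[simp] theorem natArr_setNatArr : (s.setNatArr A i v).natArr B =
    if B = A then Function.update (s.natArr A) i v else s.natArr B :=
  Function.update_apply ..
@[simp] theorem realArr_setNatArr : (s.setNatArr A i v).realArr = s.realArr := rfl

@[simp] theorem nat_setRealArr : (s.setRealArr A i a).nat = s.nat := rfl
@[simp] theorem real_setRealArr : (s.setRealArr A i a).real = s.real := rfl
@[simp] theorem natArr_setRealArr : (s.setRealArr A i a).natArr = s.natArr := rfl
@[simp] theorem realArr_setRealArr : (s.setRealArr A i a).realArr B =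
    if B = A then Function.update (s.realArr A) i a else s.realArr B :=
  Function.update_apply ..

end State

/-! ### Evaluation of stored polynomials and extraction of thresholds. -/

/-- Cell `c` of the real arrays `B, ..., B + d` holds the coefficients of `p`. -/
def PolyAt (d : ℕ) (s : State) (B c : ℕ) (p : ℝ[X]) : Prop :=
  ∀ e ≤ d, s.realArr (B + e) c = p.coeff e

/-- `s'` arises from `s` by changing real registers in `W` only. -/
structure RealFrame (W : ℕ → Prop) (s s' : State) : Prop where
  nat : s'.nat = s.nat
  natArr : s'.natArr = s.natArr
  realArr : s'.realArr = s.realArr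
  real : ∀ y, ¬ W y → s'.real y = s.real y

/-- Adds to register `out` the first terms of the polynomial in cell `ix` of the arrays `B, B + 1, ...`
at the argument in register `x`. -/
def evalTerms (B ix x out : ℕ) : ℕ → Prog
  | 0 => .skip
  | m + 1 => evalTerms B ix x out m ⨟ .op (.realLoad 11 (B + m) ix) ⨟ .op (.realMul 11 11 10) ⨟
      .op (.realAdd out out 11) ⨟ .op (.realMul 10 10 x)

/-- Register `10` carries the current power of the argument and register `11` the current term;
argument and result must lie below them. -/
theorem wp_evalTerms {d B ix x out : ℕ} (ho : out < 10) (hx : x < 10) (hxo : x ≠ out) (m : ℕ)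
    {Q : State → ℕ → Prop} {s : State} {T : ℕ} (h1 : s.real 10 = 1) (h0 : s.real out = 0)
    (h : ∀ s', RealFrame (fun y => y = out ∨ 10 ≤ y) s s' →
      s'.real out = ∑ e ∈ Finset.range m, s.realArr (B + e) (s.nat ix) * s.real x ^ e →
      s'.real 10 = s.real x ^ m → Q s' (T + (4 * m + 1))) :
    wp d (evalTerms B ix x out m) Q s T := by
  induction m generalizing Q with
  | zero => exact wp_skip (h s ⟨rfl, rfl, rfl, fun _ _ => rfl⟩ (by simpa using h0) (by simpa using h1))
  | succ m ih =>
    refine wp_seq (ih fun s' hf hs hp => ?_)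
    have hxs : s'.real x = s.real x := hf.real x (by omega)
    have e1 : out ≠ 10 := by omega
    have e2 : out ≠ 11 := by omega
    have e4 : x ≠ 11 := by omega
    refine wp_op_seq (wp_op_seq (wp_op_seq (wp_op ?_)))
    have := h (((((Op.realLoad 11 (B + m) ix).step d s' |> (Op.realMul 11 11 10).step d) |>
      (Op.realAdd out out 11).step d)) |> (Op.realMul 10 10 x).step d) ?_ ?_ ?_
    · convert this using 1; omega
    · refine ⟨?_, ?_, ?_, fun y hy => ?_⟩
      · simpa [Op.step] using hf.nat
      · simpa [Op.step] using hf.natArr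
      · simpa [Op.step] using hf.realArr
      · have := hf.real y hy
        have h1 : y ≠ 10 := by omega
        have h2 : y ≠ 11 := by omega
        have h3 : y ≠ out := by omega
        simp [Op.step, h1, h2, h3, this]
    · simp [Op.step, e1, e2, hs, hf.nat, hf.realArr, hp, Finset.sum_range_succ]
    · simp [Op.step, e4, hxo, hxs, hp, e1.symm, pow_succ]

/-- Evaluates a polynomial stored in cell `ix` of the arrays `B, ..., B + d`. -/
def evalPoly (d B ix x out : ℕ) : Prog :=
  .op (.realCast 10 3) ⨟ .op (.realAdd out 2 2) ⨟ evalTerms B ix x out (d + 1)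

/-- Natural-number register `3` and real register `2` serve as the constants 1 and 0; they
initialise the power and the accumulator. -/
theorem wp_evalPoly {d B ix x out : ℕ} {p : ℝ[X]} (ho : 4 < out) (ho' : out < 10) (hx : x < 10)
    (hxo : x ≠ out) {Q : State → ℕ → Prop} {s : State} {T : ℕ} (hone : s.nat 3 = 1)
    (hzero : s.real 2 = 0) (hp : PolyAt d s B (s.nat ix) p) (hd : p.natDegree ≤ d)
    (h : ∀ s', RealFrame (fun y => y = out ∨ 10 ≤ y) s s' → s'.real out = p.eval (s.real x) →
      Q s' (T + (4 * d + 7))) :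
    wp d (evalPoly d B ix x out) Q s T := by
  have e1 : out ≠ 10 := by omega
  have e2 : x ≠ 10 := by omega
  refine wp_op_seq (wp_op_seq (wp_evalTerms ho' hx hxo _ ?_ ?_ fun s' hf hs _ => ?_))
  · simp [Op.step, hone, e1.symm]
  · simp [Op.step, hzero]
  · have := h s' ⟨?_, ?_, ?_, fun y hy => ?_⟩ ?_
    · convert this using 1; omega
    · simpa [Op.step] using hf.nat
    · simpa [Op.step] using hf.natArr
    · simpa [Op.step] using hf.realArr
    · have h1 : y ≠ 10 := by omega
      have h2 : y ≠ out := by omega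
      simpa [Op.step, h1, h2] using hf.real y hy
    · rw [hs, Polynomial.eval_eq_sum_range' (Nat.lt_succ_of_le hd)]
      refine Finset.sum_congr rfl fun e he => ?_
      rw [← hp e (Nat.lt_succ_iff.1 (Finset.mem_range.1 he))]
      simp [Op.step, hxo, e2]

/-- Loads the difference of two stored polynomials into the real registers `20, 21, ...`. -/
def loadTerms (B₁ ix₁ B₂ ix₂ : ℕ) : ℕ → Prog
  | 0 => .skip
  | m + 1 => loadTerms B₁ ix₁ B₂ ix₂ m ⨟ .op (.realLoad (20 + m) (B₁ + m) ix₁) ⨟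
      .op (.realLoad 11 (B₂ + m) ix₂) ⨟ .op (.realSub (20 + m) (20 + m) 11)

theorem wp_loadTerms {d B₁ ix₁ B₂ ix₂ : ℕ} (m : ℕ) {Q : State → ℕ → Prop} {s : State} {T : ℕ}
    (h : ∀ s', RealFrame (fun y => 10 ≤ y) s s' →
      (∀ e < m, s'.real (20 + e) =
        s.realArr (B₁ + e) (s.nat ix₁) - s.realArr (B₂ + e) (s.nat ix₂)) → Q s' (T + (3 * m + 1))) :
    wp d (loadTerms B₁ ix₁ B₂ ix₂ m) Q s T := by
  induction m generalizing Q with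
  | zero => exact wp_skip (h s ⟨rfl, rfl, rfl, fun _ _ => rfl⟩ (by simp))
  | succ m ih =>
    refine wp_seq (ih fun s' hf hs => wp_op_seq (wp_op_seq (wp_op ?_)))
    have := h ((Op.realLoad (20 + m) (B₁ + m) ix₁).step d s' |> (Op.realLoad 11 (B₂ + m) ix₂).step d |>
      (Op.realSub (20 + m) (20 + m) 11).step d) ⟨?_, ?_, ?_, fun y hy => ?_⟩ fun e he => ?_
    · convert this using 1; omega
    · simpa [Op.step] using hf.nat
    · simpa [Op.step] using hf.natArr
    · simpa [Op.step] using hf.realArr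
    · have := hf.real y hy
      have h1 : y ≠ 20 + m := by omega
      have h2 : y ≠ 11 := by omega
      simp [Op.step, h1, h2, this]
    · have h1 : 20 + m ≠ 11 := by omega
      have h2 : 20 + e ≠ 11 := by omega
      rcases Nat.lt_succ_iff_lt_or_eq.1 he with he | rfl
      · simp [Op.step, h1, h2, he.ne, hs e he]
      · simp [Op.step, h1, hf.nat, hf.realArr]

theorem bddAbove_roots {p : ℝ[X]} (hp : p ≠ 0) : BddAbove {x : ℝ | p.eval x = 0} :=
  (Polynomial.finite_setOfPred_isRoot hp).bddAbove

theorem largestRoot_eq {d : ℕ} {a : ℕ → ℝ} {p : ℝ[X]} (hd : p.natDegree ≤ d)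
    (h : ∀ e ≤ d, a e = p.coeff e) : largestRoot d a = sSup {x : ℝ | p.eval x = 0} := by
  unfold largestRoot
  congr 1
  ext x
  rw [Set.mem_ofPred_eq, Set.mem_ofPred_eq, Polynomial.eval_eq_sum_range' (Nat.lt_succ_of_le hd)]
  rw [Finset.sum_congr rfl fun e he => by rw [h e (Nat.lt_succ_iff.1 (Finset.mem_range.1 he))]]

/-- A negative value excludes the zero polynomial, so the roots are finite in number and their
supremum, if there are any, is a root; monotonicity and the intermediate value theorem do the rest.
Without roots the supremum is 0 by convention, which lies below every admissible `lam`, as it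
should. -/
theorem le_sSup_roots_iff {p : ℝ[X]} (hp : AntitoneOn (fun x => p.eval x) (Set.Ioi 0)) {hi lam : ℝ}
    (hneg : p.eval hi < 0) (h0 : 0 < lam) (hl : lam ≤ hi) :
    lam ≤ sSup {x : ℝ | p.eval x = 0} ↔ 0 ≤ p.eval lam := by
  have hp0 : p ≠ 0 := by rintro rfl; simp at hneg
  constructor
  · intro h
    have hne : {x : ℝ | p.eval x = 0}.Nonempty := by
      by_contra hne
      rw [Set.not_nonempty_iff_eq_empty.1 hne, Real.sSup_empty] at h
      linarith
    have hmem := hne.csSup_mem (Polynomial.finite_setOfPred_isRoot hp0)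
    have := hp (Set.mem_Ioi.2 h0) (Set.mem_Ioi.2 (h0.trans_le h)) h
    exact (show p.eval (sSup {x : ℝ | p.eval x = 0}) = 0 from hmem) ▸ this
  · intro h
    obtain ⟨z, hz, hz0⟩ := intermediate_value_Icc' hl p.continuous.continuousOn ⟨hneg.le, h⟩
    exact hz.1.trans (le_csSup (bddAbove_roots hp0) hz0)

/-- Lowers the real register `3` to the threshold up to which the polynomial `p₁ - p₂ - m * X` is
nonnegative, `m` being the content of a natural-number register. Arguments above the content of the real
register `1` are not considered. -/
def lower (d B₁ ix₁ B₂ ix₂ m : ℕ) : Prog :=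
  evalPoly d B₁ ix₁ 1 6 ⨟ evalPoly d B₂ ix₂ 1 7 ⨟ .op (.realSub 6 6 7) ⨟ .op (.realCast 7 m) ⨟
    .op (.realMul 7 7 1) ⨟ .op (.realSub 6 6 7) ⨟
    .cond (.realLt 6 2)
      (loadTerms B₁ ix₁ B₂ ix₂ (d + 1) ⨟ .op (.realCast 11 m) ⨟ .op (.realSub 21 21 11) ⨟
        .op (.realRoot 6 20) ⨟ .cond (.realLt 6 3) (.op (.realAdd 3 6 2)) .skip)
      .skip

/-- The difference is antitone. If it is nonnegative at the upper end, it is so on the whole range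
and nothing changes; otherwise it is negative there and `le_sSup_roots_iff` identifies the
threshold. -/
theorem wp_lower {d B₁ ix₁ B₂ ix₂ m : ℕ} {p₁ p₂ : ℝ[X]} (hd : 1 ≤ d) {Q : State → ℕ → Prop}
    {s : State} {T : ℕ} (hone : s.nat 3 = 1) (hzero : s.real 2 = 0)
    (hp₁ : PolyAt d s B₁ (s.nat ix₁) p₁) (hp₂ : PolyAt d s B₂ (s.nat ix₂) p₂)
    (hd₁ : p₁.natDegree ≤ d) (hd₂ : p₂.natDegree ≤ d)
    (hanti : AntitoneOn (fun x => p₁.eval x - p₂.eval x - s.nat m * x) (Set.Ioi 0))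
    (h : ∀ s' T', RealFrame (fun y => y = 3 ∨ 5 ≤ y) s s' → s'.real 3 ≤ s.real 3 →
      (∀ lam, 0 < lam → lam ≤ s.real 1 → (lam ≤ s'.real 3 ↔
        lam ≤ s.real 3 ∧ p₂.eval lam + s.nat m * lam ≤ p₁.eval lam)) →
      T' ≤ T + (11 * d + 32) → Q s' T') :
    wp d (lower d B₁ ix₁ B₂ ix₂ m) Q s T := by
  refine wp_seq (wp_evalPoly (by norm_num) (by norm_num) (by norm_num) (by norm_num) hone hzero hp₁
    hd₁ fun s₁ hf₁ h₁ => wp_seq (wp_evalPoly (p := p₂) (by norm_num) (by norm_num) (by norm_num)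
    (by norm_num) ?_ ?_ ?_ hd₂ fun s₂ hf₂ h₂ => ?_))
  · rw [hf₁.nat, hone]
  · rw [hf₁.real _ (by norm_num), hzero]
  · intro e he; rw [hf₁.nat, hf₁.realArr]; exact hp₂ e he
  have hnat : s₂.nat = s.nat := by rw [hf₂.nat, hf₁.nat]
  have hnA : s₂.natArr = s.natArr := by rw [hf₂.natArr, hf₁.natArr]
  have hrA : s₂.realArr = s.realArr := by rw [hf₂.realArr, hf₁.realArr]
  have hreal : ∀ y < 5, s₂.real y = s.real y := fun y hy => by
    rw [hf₂.real y (by omega), hf₁.real y (by omega)]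
  have h6 : s₂.real 6 = p₁.eval (s.real 1) := by rw [hf₂.real _ (by norm_num), h₁]
  have h7 : s₂.real 7 = p₂.eval (s.real 1) := by rw [h₂, hf₁.real _ (by norm_num)]
  set P : ℝ[X] := p₁ - p₂ - C (s.nat m : ℝ) * X with hP
  have hPe : ∀ x, P.eval x = p₁.eval x - p₂.eval x - s.nat m * x := fun x => by simp [hP]
  have hPd : P.natDegree ≤ d := by
    refine (natDegree_sub_le _ _).trans (max_le ((natDegree_sub_le _ _).trans (max_le hd₁ hd₂)) ?_)
    exact (natDegree_C_mul_le _ _).trans (natDegree_X_le.trans hd)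
  have hPa : AntitoneOn (fun x => P.eval x) (Set.Ioi 0) := by simpa only [hPe] using hanti
  refine wp_op_seq (wp_op_seq (wp_op_seq (wp_op_seq ?_)))
  set s₃ := Op.step d (Op.step d (Op.step d (Op.step d s₂ (.realSub 6 6 7)) (.realCast 7 m))
    (.realMul 7 7 1)) (.realSub 6 6 7) with hs₃
  have k6 : s₃.real 6 = P.eval (s.real 1) := by
    simp [hs₃, Op.step, hPe, h6, h7, hnat, hreal]
  have knat : s₃.nat = s.nat := by simpa [hs₃, Op.step] using hnat
  have knA : s₃.natArr = s.natArr := by simpa [hs₃, Op.step] using hnA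
  have krA : s₃.realArr = s.realArr := by simpa [hs₃, Op.step] using hrA
  have kreal : ∀ y < 5, s₃.real y = s.real y := fun y hy => by
    have e1 : y ≠ 6 := by omega
    have e2 : y ≠ 7 := by omega
    simp [hs₃, Op.step, e1, e2, hreal y hy]
  clear_value s₃
  have hpos : ∀ lam, p₂.eval lam + s.nat m * lam ≤ p₁.eval lam ↔ 0 ≤ P.eval lam := fun lam => by
    rw [hPe]; constructor <;> intro h <;> linarith
  refine wp_cond (fun hlt => ?_) (fun hge => wp_skip ?_)
  · have hneg : P.eval (s.real 1) < 0 := by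
      simpa [Test.Holds, k6, kreal, hzero] using hlt
    refine wp_seq (wp_loadTerms _ fun s₄ hf₄ h₄ => wp_op_seq (wp_op_seq (wp_op_seq ?_)))
    have jnat : s₄.nat = s.nat := by rw [hf₄.nat, knat]
    have jreal : ∀ y < 5, s₄.real y = s.real y := fun y hy => by
      rw [hf₄.real y (by omega), kreal y hy]
    set s₅ := Op.step d (Op.step d (Op.step d s₄ (.realCast 11 m)) (.realSub 21 21 11))
      (.realRoot 6 20) with hs₅
    have inat : s₅.nat = s.nat := by simpa [hs₅, Op.step] using jnat
    have inA : s₅.natArr = s.natArr := by simpa [hs₅, Op.step, knA] using hf₄.natArr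
    have irA : s₅.realArr = s.realArr := by simpa [hs₅, Op.step, krA] using hf₄.realArr
    have ireal : ∀ y < 5, s₅.real y = s.real y := fun y hy => by
      have e1 : y ≠ 6 := by omega
      have e2 : y ≠ 21 := by omega
      have e3 : y ≠ 11 := by omega
      simp [hs₅, Op.step, e1, e2, e3, jreal y hy]
    have i6 : s₅.real 6 = sSup {x : ℝ | P.eval x = 0} := by
      simp only [hs₅, Op.step, State.real_setReal, if_true]
      refine largestRoot_eq hPd fun e he => ?_
      have e1 : 20 + e ≠ 11 := by omega
      have h4 := h₄ e (by omega)
      rw [krA, knat, hp₁ e he, hp₂ e he] at h4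
      -- Register `21` holds the coefficient of `X`, the only one affected by `m * X`.
      by_cases h1 : e = 1
      · subst h1
        simp at h4
        simp [hP, h4, jnat]
      · have e2 : 20 + e ≠ 21 := by omega
        simp [e1, e2, h4, hP, coeff_X, Ne.symm h1]
    clear_value s₅
    have hroot := fun lam h0 hl => le_sSup_roots_iff hPa hneg (lam := lam) h0 hl
    refine wp_cond (fun hlt => wp_op ?_) (fun hge => wp_skip ?_)
    · have hlt' : s₅.real 6 < s.real 3 := by
        simpa [Test.Holds, ireal] using hlt
      refine h _ _ ⟨inat, inA, irA, fun y hy => ?_⟩ ?_ (fun lam h0 hl => ?_) (by omega)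
      · have e1 : y ≠ 3 := by omega
        simp [Op.step, e1, ireal y (by omega)]
      · simp [Op.step, ireal, hzero, hlt'.le]
      · rw [hpos, ← hroot lam h0 hl, ← i6]
        simp only [Op.step, State.real_setReal, if_true, ireal 2 (by norm_num), hzero, add_zero]
        exact ⟨fun h => ⟨h.trans hlt'.le, h⟩, fun h => h.2⟩
    · have hge' : s.real 3 ≤ s₅.real 6 := by
        simpa [Test.Holds, ireal] using hge
      refine h _ _ ⟨inat, inA, irA, fun y hy => ireal y (by omega)⟩ (ireal 3 (by norm_num)).le
        (fun lam h0 hl => ?_) (by omega)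
      rw [hpos, ← hroot lam h0 hl, ← i6, ireal 3 (by norm_num)]
      exact ⟨fun h => ⟨h, h.trans hge'⟩, fun h => h.1⟩
  · have hge' : 0 ≤ P.eval (s.real 1) := by
      simpa [Test.Holds, k6, kreal, hzero] using hge
    refine h _ _ ⟨knat, knA, krA, fun y hy => kreal y (by omega)⟩ (kreal 3 (by norm_num)).le
      (fun lam h0 hl => ?_) (by omega)
    rw [hpos, kreal 3 (by norm_num)]
    exact ⟨fun h => ⟨h, hge'.trans (hPa h0 (h0.trans_le hl) hl)⟩, fun h => h.1⟩

end RealRAM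

/-! ### Chains of points and correctness of the greedy placement. -/

namespace Spacing

variable {t : ℕ} {l r : Fin t → ℝ[X]} {k n : ℕ} {lam : ℝ}

/-- `y 0, ..., y (n - 1)` lie in the first `i` intervals and consecutive ones have distance at
least `lam`. -/
structure Chain (l r : Fin t → ℝ[X]) (lam : ℝ) (i n : ℕ) (y : ℕ → ℝ) : Prop where
  mem : ∀ j < n, ∃ a : Fin t, (a : ℕ) < i ∧ y j ∈ interval l r lam a
  gap : ∀ j, j + 1 < n → y j + lam ≤ y (j + 1)

theorem Chain.add_mul_le {i n : ℕ} {y : ℕ → ℝ} (h : Chain l r lam i n y) {j : ℕ} (m : ℕ)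
    (hm : j + m < n) : y j + m * lam ≤ y (j + m) := by
  induction m with
  | zero => simp
  | succ m ih =>
    have h1 := ih (by omega)
    have h2 := h.gap (j + m) (by omega)
    push_cast
    rw [← add_assoc]
    linarith

theorem Chain.placeable (hlam : 0 < lam) {i k : ℕ} {y : ℕ → ℝ} (h : Chain l r lam i k y) :
    Placeable l r k lam := by
  refine ⟨fun a => y a, fun a => ?_, ?_⟩
  · obtain ⟨i, -, hi⟩ := h.mem a a.2
    exact ⟨i, hi⟩
  · have key : ∀ a b : Fin k, a < b → lam ≤ dist (y a) (y b) := fun a b hab => by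
      obtain ⟨m, hm⟩ := Nat.exists_eq_add_of_lt (Fin.lt_def.1 hab)
      have h1 := h.add_mul_le (j := a) (m + 1) (by have := b.2; omega)
      rw [show (a : ℕ) + (m + 1) = b by omega] at h1
      push_cast at h1
      have h2 : 0 ≤ (m : ℝ) * lam := by positivity
      rw [dist_comm, Real.dist_eq]
      exact le_trans (by linarith) (le_abs_self _)
    intro a b hab
    rcases lt_or_gt_of_ne hab with h | h
    · exact key a b h
    · rw [dist_comm]; exact key b a h

theorem Chain.mono {i i' n n' : ℕ} {y : ℕ → ℝ} (h : Chain l r lam i n y) (hi : i ≤ i')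
    (hn : n' ≤ n) : Chain l r lam i' n' y :=
  ⟨fun j hj => (h.mem j (hj.trans_le hn)).imp fun _ ha => ⟨ha.1.trans_le hi, ha.2⟩,
    fun j hj => h.gap j (hj.trans_le hn)⟩

/-- Sorting the nodes turns pairwise distances into gaps between neighbours. -/
theorem Placeable.exists_chain (h : Placeable l r k lam) : ∃ y, Chain l r lam t k y := by
  obtain ⟨x, hx, hd⟩ := h
  let y : ℕ → ℝ := fun j => if h : j < k then x (Tuple.sort x ⟨j, h⟩) else 0
  have hy : ∀ j (h : j < k), y j = x (Tuple.sort x ⟨j, h⟩) := fun j h => dif_pos h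
  refine ⟨y, fun j hj => ?_, fun j hj => ?_⟩
  · rw [hy j hj]
    exact (hx _).imp fun a ha => ⟨a.2, ha⟩
  · rw [hy j (by omega), hy (j + 1) hj]
    have hmono := Tuple.monotone_sort x
      (show (⟨j, by omega⟩ : Fin k) ≤ ⟨j + 1, hj⟩ from Fin.mk_le_mk.2 (by omega))
    have hdist := hd (Tuple.sort x ⟨j, by omega⟩) (Tuple.sort x ⟨j + 1, hj⟩) (by simp)
    simp only [Function.comp] at hmono
    rw [dist_comm, Real.dist_eq, abs_of_nonneg (by linarith)] at hdist
    linarith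

/-- There is a chain of `n` points in the first `i` intervals after which the next point may be
placed at `p`. -/
def Reached (l r : Fin t → ℝ[X]) (lam : ℝ) (i n : ℕ) (p : ℝ) : Prop :=
  ∃ x, Chain l r lam i n x ∧ (0 < n → p = x (n - 1) + lam)

/-- In every chain of `k` points, the one with index `n` is at least `p` and not in the first `i`
intervals. -/
def Ahead (l r : Fin t → ℝ[X]) (k : ℕ) (lam : ℝ) (i n : ℕ) (p : ℝ) : Prop :=
  ∀ y, Chain l r lam t k y → n < k →
    (∀ a : Fin t, y n ∈ interval l r lam a → i ≤ a) ∧ (0 < n → p ≤ y n)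

theorem reached_zero (i : ℕ) (p : ℝ) : Reached l r lam i 0 p :=
  ⟨fun _ => 0, ⟨by simp, by simp⟩, by simp⟩

theorem ahead_zero (p : ℝ) : Ahead l r k lam 0 0 p := fun _ _ _ => ⟨by simp, by simp⟩

theorem Reached.mono {i i' : ℕ} {p : ℝ} (h : Reached l r lam i n p) (hi : i ≤ i') :
    Reached l r lam i' n p := by
  obtain ⟨x, hx, hp⟩ := h
  exact ⟨x, hx.mono hi le_rfl, hp⟩

theorem Reached.placeable {i : ℕ} {p : ℝ} (hlam : 0 < lam) (h : Reached l r lam i n p) (hk : k ≤ n) :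
    Placeable l r k lam := by
  obtain ⟨x, hx, -⟩ := h
  exact (hx.mono le_rfl hk).placeable hlam

/-- The new points are `q, q + lam, ...`. The bound `i ≤ a + 1` rather than `i ≤ a` allows further
points in an interval already in use. -/
theorem Reached.step {i b : ℕ} {p q : ℝ} {a : Fin t} (hlam : 0 < lam) (h : Reached l r lam i n p)
    (hi : i ≤ a + 1) (hq : (l a).eval lam ≤ q) (hpq : 0 < n → p ≤ q) (hb : 0 < b)
    (hr : q + (b - 1) * lam ≤ (r a).eval lam) :
    Reached l r lam (a + 1) (n + b) (q + b * lam) := by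
  obtain ⟨x, hx, hp⟩ := h
  refine ⟨fun j => if j < n then x j else q + ((j : ℝ) - n) * lam, ⟨fun j hj => ?_, fun j hj => ?_⟩,
    fun _ => ?_⟩
  · by_cases h : j < n
    · simp only [h, if_true]
      exact (hx.mono hi le_rfl).mem j h
    · simp only [h, if_false]
      refine ⟨a, by omega, ?_, ?_⟩
      · have : (n : ℝ) ≤ j := by exact_mod_cast not_lt.1 h
        have : 0 ≤ ((j : ℝ) - n) * lam := mul_nonneg (by linarith) hlam.le
        linarith
      · have : (j : ℝ) + 1 ≤ n + b := by exact_mod_cast hj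
        have : ((j : ℝ) - n) * lam ≤ (b - 1) * lam := mul_le_mul_of_nonneg_right (by linarith) hlam.le
        linarith
  · by_cases h : j + 1 < n
    · simp only [h, if_true, (Nat.lt_succ_self j).trans h]
      exact hx.gap j h
    · by_cases h' : j < n
      · have e : j + 1 = n := by omega
        have := hp (by omega)
        have := hpq (by omega)
        simp only [h', if_true, e, lt_irrefl, if_false, sub_self, zero_mul, add_zero]
        rw [show j = n - 1 by omega]
        linarith
      · simp only [h, h', if_false]
        push_cast
        linarith
  · have h1 : ¬ n + b - 1 < n := by omega
    simp only [h1, if_false]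
    rw [Nat.cast_sub (by omega)]
    push_cast
    ring

/-- A point outside the first `a` intervals lies in interval `a` or to its right. Nonemptiness of
interval `a` is essential: sortedness compares points of intervals, and the left end has to be one.
-/
theorem Ahead.lower_bound {p q : ℝ} {a : Fin t} (hs : SortedDisjoint l r) (hlam : 0 < lam)
    (h : Ahead l r k lam a n p) (hne : (l a).eval lam ≤ (r a).eval lam)
    (hq : q ≤ (l a).eval lam ∨ 0 < n ∧ q ≤ p) {y : ℕ → ℝ} (hy : Chain l r lam t k y) (hn : n < k) :
    q ≤ y n := by
  obtain ⟨h1, h2⟩ := h y hy hn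
  rcases hq with hq | ⟨hn0, hq⟩
  · obtain ⟨a', -, ha'⟩ := hy.mem n hn
    rcases (h1 a' ha').eq_or_lt with e | e
    · rw [← Fin.ext e] at ha'
      exact hq.trans ha'.1
    · exact hq.trans (hs lam hlam a a' e _ ⟨le_rfl, hne⟩ _ ha').le
  · exact hq.trans (h2 hn0)

/-- Point `n + b` is `b` gaps beyond point `n`, so it inherits the bound shifted by `b * lam` and
cannot fall back into an earlier interval. -/
theorem Ahead.step {p q : ℝ} {a : Fin t} (hs : SortedDisjoint l r) (hlam : 0 < lam)
    (h : Ahead l r k lam a n p) (hne : (l a).eval lam ≤ (r a).eval lam)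
    (hq : q ≤ (l a).eval lam ∨ 0 < n ∧ q ≤ p) (b : ℕ) : Ahead l r k lam a (n + b) (q + b * lam) := by
  intro y hy hn
  have hlb := h.lower_bound hs hlam hne hq hy (by omega)
  have hgap := hy.add_mul_le (j := n) b hn
  refine ⟨fun a' ha' => ?_, fun _ => by linarith⟩
  obtain ⟨c, -, hc⟩ := hy.mem n (by omega)
  have h1 := (h y hy (by omega)).1 c hc
  by_contra hlt
  have := hs lam hlam a' c (Fin.lt_def.2 (by omega)) _ ha' _ hc
  have : 0 ≤ b * lam := by positivity
  linarith

/-- Interval `a` cannot contain point `n`: it is empty, or it ends before the lower bound for that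
point. -/
theorem Ahead.next {p : ℝ} {a : Fin t}
    (h : Ahead l r k lam a n p) (hfail : (r a).eval lam < (l a).eval lam ∨
      0 < n ∧ (r a).eval lam < p) : Ahead l r k lam (a + 1) n p := by
  intro y hy hn
  obtain ⟨h1, h2⟩ := h y hy hn
  refine ⟨fun a' ha' => ?_, h2⟩
  rcases (h1 a' ha').eq_or_lt with e | e
  · rw [← Fin.ext e] at ha'
    rcases hfail with hf | ⟨hn0, hf⟩
    · exact absurd (ha'.1.trans ha'.2) (not_le.2 hf)
    · exact absurd ((h2 hn0).trans ha'.2) (not_le.2 hf)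
  · exact e

theorem Ahead.not_placeable {p : ℝ} (h : Ahead l r k lam t n p) (hn : n < k) :
    ¬ Placeable l r k lam := by
  intro hp
  obtain ⟨y, hy⟩ := hp.exists_chain
  obtain ⟨a, -, ha⟩ := hy.mem n hn
  exact absurd ((h y hy hn).1 a ha) (by omega)

/-! ### The feasible set is a half-open interval `(0, M]`. -/

section feasible

theorem eval_left_mono (h : Shrinking l r) {lam mu : ℝ} (h0 : 0 < lam) (hle : lam ≤ mu) (i : Fin t) :
    (l i).eval lam ≤ (l i).eval mu := (h i).1 h0 (h0.trans_le hle) hle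

theorem eval_right_anti (h : Shrinking l r) {lam mu : ℝ} (h0 : 0 < lam) (hle : lam ≤ mu) (i : Fin t) :
    (r i).eval mu ≤ (r i).eval lam := (h i).2 h0 (h0.trans_le hle) hle

theorem interval_anti (h : Shrinking l r) {lam mu : ℝ} (h0 : 0 < lam) (hle : lam ≤ mu) (i : Fin t) :
    interval l r mu i ⊆ interval l r lam i :=
  Set.Icc_subset_Icc (eval_left_mono h h0 hle i) (eval_right_anti h h0 hle i)

theorem Placeable.anti (h : Shrinking l r) {lam mu : ℝ} (h0 : 0 < lam) (hle : lam ≤ mu)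
    (hp : Placeable l r k mu) : Placeable l r k lam := by
  obtain ⟨x, hx, hd⟩ := hp
  exact ⟨x, fun a => (hx a).imp fun i hi => interval_anti h h0 hle i hi,
    fun a b hab => hle.trans (hd a b hab)⟩

/-- A parameter that is too large for two nodes. -/
noncomputable def upperBound (l r : Fin t → ℝ[X]) : ℝ :=
  1 + ∑ i, (((l i).eval 1) ^ 2 + ((r i).eval 1) ^ 2)

theorem one_le_upperBound : 1 ≤ upperBound l r :=
  le_add_of_nonneg_right (Finset.sum_nonneg fun _ _ => by positivity)

theorem sub_lt_upperBound (i j : Fin t) : (r i).eval 1 - (l j).eval 1 < upperBound l r := by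
  have h1 : ((r i).eval 1) ^ 2 ≤ ∑ i, ((r i).eval 1) ^ 2 :=
    Finset.single_le_sum (f := fun i => ((r i).eval 1) ^ 2) (fun _ _ => by positivity)
      (Finset.mem_univ i)
  have h2 : ((l j).eval 1) ^ 2 ≤ ∑ i, ((l i).eval 1) ^ 2 :=
    Finset.single_le_sum (f := fun i => ((l i).eval 1) ^ 2) (fun _ _ => by positivity)
      (Finset.mem_univ j)
  rw [upperBound, Finset.sum_add_distrib]
  -- Replacing `x` by `x ^ 2 + 1 / 4` for `r i` and for `-l j` costs 1/2 in total, less than the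
  -- summand 1.
  nlinarith [sq_nonneg ((r i).eval 1 - 1 / 2), sq_nonneg ((l j).eval 1 + 1 / 2)]

theorem not_placeable_upperBound (h : Shrinking l r) (hk : 2 ≤ k) :
    ¬ Placeable l r k (upperBound l r) := by
  rintro ⟨x, hx, hd⟩
  have hb : ∀ a b, x a - x b < upperBound l r := fun a b => by
    obtain ⟨i, hi⟩ := hx a
    obtain ⟨j, hj⟩ := hx b
    have h1 := (interval_anti h one_pos one_le_upperBound i hi).2
    have h2 := (interval_anti h one_pos one_le_upperBound j hj).1
    have := sub_lt_upperBound (l := l) (r := r) i j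
    linarith
  have := hd ⟨0, by omega⟩ ⟨1, by omega⟩ (by simp)
  rw [Real.dist_eq] at this
  exact absurd this (not_le.2 (abs_lt.2 ⟨by linarith [hb ⟨1, by omega⟩ ⟨0, by omega⟩], hb _ _⟩))

theorem lt_upperBound (h : Shrinking l r) (hk : 2 ≤ k) (hlam : lam ∈ feasible l r k) :
    lam < upperBound l r := by
  by_contra hle
  exact not_placeable_upperBound h hk
    (hlam.2.anti h (one_pos.trans_le one_le_upperBound) (not_lt.1 hle))

/-- The pairs of a parameter in `[lam₀, U]` and a valid placement form a closed set. It is compact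
because all nodes lie in the intervals at `lam₀`, so its projection to the parameter has a greatest
element. -/
theorem exists_feasible_eq (h : Shrinking l r) (hk : 2 ≤ k) (hne : (feasible l r k).Nonempty) :
    ∃ M, 0 < M ∧ feasible l r k = Set.Ioc 0 M := by
  obtain ⟨lam₀, h0, hp0⟩ := hne
  set U := upperBound l r with hU
  have hUpos : lam₀ < U := lt_upperBound h hk ⟨h0, hp0⟩
  let S : Set (ℝ × (Fin k → ℝ)) := {z | z.1 ∈ Set.Icc lam₀ U ∧
    (∀ a, ∃ i, z.2 a ∈ interval l r z.1 i) ∧ ∀ a b, a ≠ b → z.1 ≤ dist (z.2 a) (z.2 b)}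
  have hclosed : IsClosed S := by
    have e : S = {z | z.1 ∈ Set.Icc lam₀ U} ∩ ((⋂ a, ⋃ i, {z | z.2 a ∈ interval l r z.1 i}) ∩
        ⋂ a, ⋂ b, ⋂ _ : a ≠ b, {z | z.1 ≤ dist (z.2 a) (z.2 b)}) := by
      ext z; simp [S]
    rw [e]
    refine (isClosed_Icc.preimage continuous_fst).inter (IsClosed.inter ?_ ?_)
    · refine isClosed_iInter fun a => isClosed_iUnion_of_finite fun i => ?_
      have h1 : Continuous fun z : ℝ × (Fin k → ℝ) => (l i).eval z.1 :=
        (l i).continuous.comp continuous_fst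
      have h2 : Continuous fun z : ℝ × (Fin k → ℝ) => (r i).eval z.1 :=
        (r i).continuous.comp continuous_fst
      have h3 : Continuous fun z : ℝ × (Fin k → ℝ) => z.2 a := by fun_prop
      exact (isClosed_le h1 h3).inter (isClosed_le h3 h2)
    · refine isClosed_iInter fun a => isClosed_iInter fun b => isClosed_iInter fun _ => ?_
      exact isClosed_le (by fun_prop) (by fun_prop)
  let B : Set ℝ := ⋃ i, interval l r lam₀ i
  have hB : IsCompact B := isCompact_iUnion fun i => isCompact_Icc
  have hS : IsCompact S := by
    refine ((isCompact_Icc (a := lam₀) (b := U)).prod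
      (isCompact_univ_pi fun _ : Fin k => hB)).of_isClosed_subset hclosed fun z hz => ?_
    refine ⟨hz.1, fun a _ => ?_⟩
    obtain ⟨i, hi⟩ := hz.2.1 a
    exact Set.mem_iUnion.2 ⟨i, interval_anti h h0 hz.1.1 i hi⟩
  obtain ⟨x₀, hx₀⟩ := hp0
  obtain ⟨M, ⟨⟨M', x⟩, hzS, rfl⟩, hM⟩ := (hS.image continuous_fst).exists_isGreatest
    ⟨lam₀, ⟨lam₀, x₀⟩, ⟨⟨le_rfl, hUpos.le⟩, hx₀⟩, rfl⟩
  have hMpos : 0 < M' := h0.trans_le hzS.1.1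
  refine ⟨M', hMpos, Set.ext fun lam => ⟨fun hl => ⟨hl.1, ?_⟩, fun hl => ⟨hl.1, ?_⟩⟩⟩
  · rcases le_total lam lam₀ with hle | hle
    · exact hle.trans hzS.1.1
    · obtain ⟨x', hx'⟩ := hl.2
      exact hM ⟨⟨lam, x'⟩, ⟨⟨hle, (lt_upperBound h hk hl).le⟩, hx'⟩, rfl⟩
  · exact Placeable.anti h hl.1 hl.2 ⟨x, hzS.2⟩

end feasible

end Spacing

/-! ### Greedy placement with a symbolic parameter. -/

namespace Spacing

variable {t : ℕ} {l r : Fin t → ℝ[X]} {k n : ℕ} {lam : ℝ}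

/-- An interval of length `w ≥ 0` holds at most `w / lam + 1` points of a chain, hence at most two
if `w ≤ lam`. So the intervals outside `E` contribute only to the error term `2 * t * lam`. -/
theorem Chain.mul_le_sum {y : ℕ → ℝ} (hy : Chain l r lam t k y) (hlam : 0 < lam)
    (E : Finset (Fin t)) (hE : ∀ i ∈ E, lam ≤ (r i).eval lam - (l i).eval lam)
    (hE' : ∀ i ∉ E, (r i).eval lam - (l i).eval lam ≤ lam) :
    k * lam ≤ ∑ i ∈ E, ((r i).eval lam - (l i).eval lam) + 2 * t * lam := by
  classical
  rcases Nat.eq_zero_or_pos k with rfl | hk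
  · have : 0 ≤ ∑ i ∈ E, ((r i).eval lam - (l i).eval lam) :=
      Finset.sum_nonneg fun i hi => hlam.le.trans (hE i hi)
    have : 0 ≤ 2 * t * lam := by positivity
    push_cast
    linarith
  have : Nonempty (Fin t) := ⟨(hy.mem 0 hk).choose⟩
  choose! f hf using fun j (hj : j < k) => (hy.mem j hj)
  let c : Fin t → Finset ℕ := fun i => (Finset.range k).filter fun j => f j = i
  have hcard : ∀ i, ((c i).card : ℝ) * lam ≤
      (if i ∈ E then (r i).eval lam - (l i).eval lam else 0) + 2 * lam := by
    intro i
    have hpos : 0 ≤ if i ∈ E then (r i).eval lam - (l i).eval lam else 0 := by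
      split_ifs with hi
      · exact hlam.le.trans (hE i hi)
      · exact le_rfl
    rcases (c i).eq_empty_or_nonempty with he | hne
    · rw [he]; simp; linarith
    · have h1 := Finset.mem_filter.1 ((c i).min'_mem hne)
      have h2 := Finset.mem_filter.1 ((c i).max'_mem hne)
      have hle := (c i).min'_le_max' hne
      obtain ⟨m, hm⟩ := Nat.exists_eq_add_of_le hle
      have h3 := hf _ (Finset.mem_range.1 h1.1)
      have h4 := hf _ (Finset.mem_range.1 h2.1)
      rw [h1.2] at h3
      rw [h2.2, hm] at h4
      have h5 := hy.add_mul_le (j := (c i).min' hne) m (by rw [← hm]; exact Finset.mem_range.1 h2.1)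
      have h6 : (c i).card ≤ m + 1 := by
        have : c i ⊆ Finset.Icc ((c i).min' hne) ((c i).max' hne) := fun j hj =>
          Finset.mem_Icc.2 ⟨Finset.min'_le _ _ hj, Finset.le_max' _ _ hj⟩
        have := Finset.card_le_card this
        rw [Nat.card_Icc] at this
        omega
      have h7 : ((c i).card : ℝ) ≤ m + 1 := by exact_mod_cast h6
      have h8 : ((c i).card : ℝ) * lam ≤ (m + 1) * lam := mul_le_mul_of_nonneg_right h7 hlam.le
      have h9 : m * lam ≤ (r i).eval lam - (l i).eval lam := by
        have := h3.2.1; have := h4.2.2; linarith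
      split_ifs with hi
      · linarith
      · have := hE' i hi; linarith
  have hsum : (k : ℝ) = ∑ i, ((c i).card : ℝ) := by
    have := Finset.card_eq_sum_card_fiberwise (f := f) (s := Finset.range k) (t := Finset.univ)
      (fun _ _ => Finset.mem_coe.2 (Finset.mem_univ _))
    rw [Finset.card_range] at this
    exact_mod_cast this
  calc (k : ℝ) * lam = ∑ i, ((c i).card : ℝ) * lam := by rw [hsum, Finset.sum_mul]
    _ ≤ ∑ i, ((if i ∈ E then (r i).eval lam - (l i).eval lam else 0) + 2 * lam) :=
      Finset.sum_le_sum fun i _ => hcard i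
    _ = _ := by
      rw [Finset.sum_add_distrib, Finset.sum_ite_mem, Finset.univ_inter]
      simp; ring

/-- Lower bound for the point with index `n` if `x = (a, m)` records that the point with index `m` is in
the interval `a`. -/
noncomputable def pos (l : Fin t → ℝ[X]) (lam : ℝ) (n : ℕ) (x : Fin t × ℕ) : ℝ :=
  (l x.1).eval lam + ((n : ℝ) - x.2) * lam

theorem pos_add (n b : ℕ) (x : Fin t × ℕ) : pos l lam (n + b) x = pos l lam n x + b * lam := by
  simp only [pos]; push_cast; ring

/-- `p` is the largest of the lower bounds in `L` for the point with index `n`. -/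
structure IsStart (l : Fin t → ℝ[X]) (lam : ℝ) (L : List (Fin t × ℕ)) (n : ℕ) (p : ℝ) : Prop where
  le : ∀ x ∈ L, pos l lam n x ≤ p
  mem : 0 < n → ∃ x ∈ L, pos l lam n x = p

/-- All old bounds move by `b * lam`. The new start is the larger of the old one and the left end of
`a`, attained by an old record or by the new one. -/
theorem IsStart.push {L : List (Fin t × ℕ)} {p q : ℝ} (h : IsStart l lam L n p)
    (hL : ∀ x ∈ L, x.2 < n) {a : Fin t} (b : ℕ) (hq : (l a).eval lam ≤ q) (hpq : 0 < n → p ≤ q)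
    (hmem : q = (l a).eval lam ∨ 0 < n ∧ q = p) :
    IsStart l lam (L ++ [(a, n)]) (n + b) (q + b * lam) := by
  refine ⟨fun x hx => ?_, fun _ => ?_⟩
  · rw [pos_add]
    rcases List.mem_append.1 hx with hx | hx
    · have := h.le x hx
      have := hpq (by have := hL x hx; omega)
      linarith
    · rw [List.mem_singleton.1 hx]
      simp [pos, hq]
  · rcases hmem with rfl | ⟨hn, rfl⟩
    · exact ⟨(a, n), by simp, by rw [pos_add]; simp [pos]⟩
    · obtain ⟨x, hx, hxe⟩ := h.mem hn
      exact ⟨x, List.mem_append_left _ hx, by rw [pos_add, hxe]⟩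

/-- The intervals leave room for `b` more points in the interval `a`. -/
def Fits (l r : Fin t → ℝ[X]) (L : List (Fin t × ℕ)) (n : ℕ) (a : Fin t) (b : ℕ) (lam : ℝ) : Prop :=
  ∀ x ∈ L ++ [(a, n)], pos l lam (n + b - 1) x ≤ (r a).eval lam

/-- State of the greedy placement with a symbolic parameter: the largest feasible parameter `M` is
in `[lo, hi)`. -/
structure Greedy (l r : Fin t → ℝ[X]) (k : ℕ) (M lo hi : ℝ) (i i' n : ℕ) (L : List (Fin t × ℕ)) :
    Prop where
  lt : ∀ x ∈ L, x.2 < n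
  reached : ∀ lam, 0 < lam → lam ≤ hi → ∃ p, IsStart l lam L n p ∧ Reached l r lam i n p
  ahead : ∀ lam, lo < lam → lam ≤ M → ∃ p, IsStart l lam L n p ∧ Ahead l r k lam i' n p

namespace Greedy

variable {M lo hi cand : ℝ} {i i' b : ℕ} {a : Fin t} {L : List (Fin t × ℕ)}

theorem zero : Greedy l r k M lo hi 0 0 0 [] :=
  ⟨by simp, fun _ _ _ => ⟨0, ⟨by simp, by simp⟩, reached_zero _ _⟩,
    fun _ _ _ => ⟨0, ⟨by simp, by simp⟩, ahead_zero _⟩⟩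

theorem mono (h : Greedy l r k M lo hi i i' n L) {j : ℕ} (hij : i ≤ j) {lo' : ℝ} (hlo : lo ≤ lo') :
    Greedy l r k M lo' hi j i' n L :=
  ⟨h.lt, fun lam h0 h1 => (h.reached lam h0 h1).imp fun _ hp => ⟨hp.1, hp.2.mono hij⟩,
    fun lam h0 h1 => h.ahead lam (hlo.trans_lt h0) h1⟩

/-- The placement is valid up to and including `hi`; with `k` points it would make `hi > M`
feasible. -/
theorem lt_of_feasible (h : Greedy l r k M lo hi i i' n L) (hM : 0 < M)
    (hF : feasible l r k = Set.Ioc 0 M) (hhi : M < hi) : n < k := by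
  by_contra hn
  obtain ⟨p, -, hp⟩ := h.reached hi (hM.trans hhi) le_rfl
  have : hi ∈ feasible l r k := ⟨hM.trans hhi, hp.placeable (hM.trans hhi) (not_lt.1 hn)⟩
  rw [hF] at this
  exact absurd this.2 (not_le.2 hhi)

/-- If `lo < M`, then at the parameter `M` point `n < k` of every chain of `k` points would lie
beyond all intervals. -/
theorem eq_of_done (h : Greedy l r k M lo hi i t n L) (hM : 0 < M)
    (hF : feasible l r k = Set.Ioc 0 M) (hlo : lo ≤ M) (hhi : M < hi) : lo = M := by
  by_contra hne
  obtain ⟨p, -, hp⟩ := h.ahead M (lt_of_le_of_ne hlo hne) le_rfl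
  have : M ∈ feasible l r k := by rw [hF]; exact ⟨hM, le_rfl⟩
  exact hp.not_placeable (h.lt_of_feasible hM hF hhi) this.2

/-- The greedy start is the maximum of the left end and `p`, except that `p` carries no information
while no point is placed. -/
theorem exists_start (p : ℝ) (a : Fin t) : ∃ q, (l a).eval lam ≤ q ∧ (0 < n → p ≤ q) ∧
    (q = (l a).eval lam ∨ 0 < n ∧ q = p) := by
  rcases Nat.eq_zero_or_pos n with rfl | hn
  · exact ⟨_, le_rfl, by simp, .inl rfl⟩
  · rcases le_total ((l a).eval lam) p with h | h
    · exact ⟨p, h, fun _ => le_rfl, .inr ⟨hn, rfl⟩⟩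
    · exact ⟨_, le_rfl, fun _ => h, .inl rfl⟩

/-- A threshold above `M` becomes the new upper end, and up to it the block fits. The lower bounds
advance too, since the block fits at all parameters in `(lo, M]`. -/
theorem push (h : Greedy l r k M lo hi i a n L) (hs : SortedDisjoint l r) (hlo : 0 ≤ lo)
    (hi' : i ≤ a + 1) (hb : 0 < b) (hle : cand ≤ hi) (hMc : M < cand)
    (hc : ∀ lam, 0 < lam → lam ≤ hi → (lam ≤ cand ↔ Fits l r L n a b lam)) :
    Greedy l r k M lo cand (a + 1) a (n + b) (L ++ [(a, n)]) := by
  have hcast : ((n + b - 1 : ℕ) : ℝ) = n + b - 1 := by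
    rw [Nat.cast_sub (by omega)]; push_cast; ring
  have hpos : ∀ lam x, pos l lam (n + b - 1) x = pos l lam n x + ((b : ℝ) - 1) * lam := fun lam x => by
    simp only [pos, hcast]; ring
  refine ⟨fun x hx => ?_, fun lam h0 h1 => ?_, fun lam h0 h1 => ?_⟩
  · rcases List.mem_append.1 hx with hx | hx
    · have := h.lt x hx; omega
    · rw [List.mem_singleton.1 hx]; simpa using hb
  · obtain ⟨p, hst, hp⟩ := h.reached lam h0 (h1.trans hle)
    have hfit := (hc lam h0 (h1.trans hle)).1 h1
    obtain ⟨q, hq, hpq, hmem⟩ := exists_start (l := l) (lam := lam) (n := n) p a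
    refine ⟨_, hst.push h.lt b hq hpq hmem, hp.step h0 hi' hq hpq hb ?_⟩
    rcases hmem with rfl | ⟨hn, rfl⟩
    · have := hfit (a, n) (by simp)
      rw [hpos] at this
      simpa [pos] using this
    · obtain ⟨x, hx, hxe⟩ := hst.mem hn
      have := hfit x (List.mem_append_left _ hx)
      rwa [hpos, hxe] at this
  · have hlam : 0 < lam := hlo.trans_lt h0
    obtain ⟨p, hst, hp⟩ := h.ahead lam h0 h1
    have hfit := (hc lam hlam (h1.trans (hMc.le.trans hle))).1 (h1.trans hMc.le)
    obtain ⟨q, hq, hpq, hmem⟩ := exists_start (l := l) (lam := lam) (n := n) p a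
    refine ⟨_, hst.push h.lt b hq hpq hmem, hp.step hs hlam ?_ (hmem.imp Eq.le fun h => ⟨h.1, h.2.le⟩) b⟩
    -- The tentative record `(a, n)` fits as well, which shows that interval `a` is nonempty.
    have := hfit (a, n) (by simp)
    rw [hpos] at this
    simp only [pos, sub_self, zero_mul, add_zero] at this
    have h1b : (1 : ℝ) ≤ b := by exact_mod_cast hb
    have : 0 ≤ ((b : ℝ) - 1) * lam := mul_nonneg (by linarith) hlam.le
    linarith

/-- For `lam > lo` some record violates the fit of a single point. An old record puts the start
beyond the right end; the new record says that the interval is empty. -/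
theorem next (h : Greedy l r k M lo hi i a n L) (hlo : 0 ≤ lo) (hi' : i ≤ a + 1) (hhi : M < hi)
    (hcl : cand ≤ lo)
    (hc : ∀ lam, 0 < lam → lam ≤ hi → (lam ≤ cand ↔ Fits l r L n a 1 lam)) :
    Greedy l r k M lo hi (a + 1) (a + 1) n L := by
  refine ⟨h.lt, (h.mono hi' le_rfl).reached, fun lam h0 h1 => ?_⟩
  obtain ⟨p, hst, hp⟩ := h.ahead lam h0 h1
  refine ⟨p, hst, hp.next ?_⟩
  have hfit := mt (hc lam (hlo.trans_lt h0) (h1.trans hhi.le)).2 (not_le.2 (hcl.trans_lt h0))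
  simp only [Fits, not_forall, not_le, exists_prop, Nat.add_sub_cancel] at hfit
  obtain ⟨x, hx, hlt⟩ := hfit
  rcases List.mem_append.1 hx with hx | hx
  · exact .inr ⟨by have := h.lt x hx; omega, hlt.trans_le (hst.le x hx)⟩
  · rw [List.mem_singleton.1 hx] at hlt
    exact .inl (by simpa [pos] using hlt)

/-- Before the first push into `a`, all points lie strictly left of it, so the start is below `l a +
lam`. Hence length `b * lam` suffices for `b` points, and the block fits at some parameter above
`M`. -/
theorem lt_of_jump (h : Greedy l r k M lo hi a a n L) (hs : SortedDisjoint l r) (hM : 0 < M)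
    (hhi : M < hi) (hjump : ∃ δ, M < δ ∧
      ∀ lam, M < lam → lam < δ → b * lam ≤ (r a).eval lam - (l a).eval lam)
    (hb : 0 < b) (hc : ∀ lam, 0 < lam → lam ≤ hi → (lam ≤ cand ↔ Fits l r L n a b lam)) :
    M < cand := by
  obtain ⟨δ, hδ, hj⟩ := hjump
  obtain ⟨lam, h1, h2⟩ := exists_between (lt_min hδ hhi)
  obtain ⟨h2, h3⟩ := lt_min_iff.1 h2
  have h0 := hM.trans h1
  refine h1.trans_le ((hc lam h0 h3.le).2 fun x hx => ?_)
  have hroom := hj lam h1 h2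
  have hcast : ((n + b - 1 : ℕ) : ℝ) = n + b - 1 := by
    rw [Nat.cast_sub (by omega)]; push_cast; ring
  have hpos : pos l lam (n + b - 1) x = pos l lam n x + ((b : ℝ) - 1) * lam := by
    simp only [pos, hcast]; ring
  rw [hpos]
  obtain ⟨p, hst, y, hy, hp⟩ := h.reached lam h0 h3.le
  have h1b : 0 ≤ b * lam := by positivity
  rcases List.mem_append.1 hx with hx | hx
  · have hn : 0 < n := by have := h.lt x hx; omega
    obtain ⟨a', ha', hmem⟩ := hy.mem (n - 1) (by omega)
    have hlt := hs lam h0 a' a (Fin.lt_def.2 ha') _ hmem _ ⟨le_rfl, by linarith⟩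
    have := hst.le x hx
    have := hp hn
    linarith
  · rw [List.mem_singleton.1 hx]
    simp only [pos, sub_self, zero_mul, add_zero]
    linarith

end Greedy

/-- The hypothesis gives length at least `(c + 2) * β`, one `β` more than needed. This slack passes
to parameters above `M` by continuity if `β = M`; if `M < β`, monotonicity below `β` is enough. -/
theorem exists_room_above (h : Shrinking l r) {M β : ℝ} (hM : 0 < M) (hβ : M ≤ β) {a : Fin t} {c : ℕ}
    (hc : 0 < c) (hroom : (l a).eval β + 3 * β + (c - 1) * β ≤ (r a).eval β) :
    ∃ δ, M < δ ∧ ∀ lam, M < lam → lam < δ →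
      ((c + 1 : ℕ) : ℝ) * lam ≤ (r a).eval lam - (l a).eval lam := by
  have hβ0 := hM.trans_le hβ
  rcases hβ.eq_or_lt with rfl | hlt
  · have hcont : ContinuousAt (fun lam => (r a).eval lam - (l a).eval lam - ((c + 1 : ℕ) : ℝ) * lam) M :=
      by fun_prop
    have hev := hcont.eventually (lt_mem_nhds (a := 0) (by push_cast; nlinarith))
    obtain ⟨ε, hε, hball⟩ := Metric.eventually_nhds_iff.1 hev
    refine ⟨M + ε, by linarith, fun lam h1 h2 => ?_⟩
    have := hball (y := lam) (by rw [Real.dist_eq, abs_of_pos (by linarith)]; linarith)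
    linarith
  · refine ⟨β, hlt, fun lam h1 h2 => ?_⟩
    have h3 := eval_left_mono h (hM.trans h1) h2.le a
    have h4 := eval_right_anti h (hM.trans h1) h2.le a
    have h5 : ((c + 1 : ℕ) : ℝ) * lam ≤ ((c + 1 : ℕ) : ℝ) * β :=
      mul_le_mul_of_nonneg_left h2.le (by positivity)
    push_cast at h5 ⊢
    linarith

/-- Maximality of `h i` bounds each length by `(h i + 3) * β`. Summation over `E` gives `k - 2 * t ≤
3 * t + ∑ h i`, while `u + ∑ h i < k`. -/
theorem pushes_le {β : ℝ} (hβ : 0 < β) {E : Finset (Fin t)} {h : Fin t → ℕ} {u : ℕ}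
    (hn : n = u + ∑ i, h i) (hnk : n < k)
    (hmax : ∀ i, k ≤ h i ∨ (r i).eval β < (l i).eval β + 3 * β + h i * β)
    (hE : ((k - 2 * t : ℕ) : ℝ) * β ≤ ∑ i ∈ E, ((r i).eval β - (l i).eval β)) : u ≤ 5 * t := by
  have h1 : ∀ i, (r i).eval β - (l i).eval β ≤ (3 + h i) * β := fun i => by
    have : h i ≤ ∑ i, h i := Finset.single_le_sum (fun _ _ => Nat.zero_le _) (Finset.mem_univ i)
    -- The capped case is impossible, because `h i ≤ n < k`.
    have := (hmax i).resolve_left (by omega)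
    linarith
  have h2 : ((k - 2 * t : ℕ) : ℝ) * β ≤ (3 * t + ∑ i, h i : ℕ) * β := by
    calc _ ≤ ∑ i ∈ E, ((r i).eval β - (l i).eval β) := hE
      _ ≤ ∑ i ∈ E, (3 + h i : ℝ) * β := Finset.sum_le_sum fun i _ => h1 i
      _ ≤ ∑ i, (3 + h i : ℝ) * β := Finset.sum_le_sum_of_subset_of_nonneg (Finset.subset_univ _)
        fun i _ _ => by positivity
      _ = _ := by
        rw [← Finset.sum_mul, Finset.sum_add_distrib]
        push_cast
        simp
        left; ring
  have h3 : k - 2 * t ≤ 3 * t + ∑ i, h i := by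
    exact_mod_cast le_of_mul_le_mul_right h2 hβ
  omega

end Spacing

/-! ### Decision of a fixed parameter on the machine. -/

namespace RealRAM

open Spacing

/-- `s'` arises from `s` by changing natural-number registers in `N` and real registers in `W` only. -/
structure Frame (N W : ℕ → Prop) (s s' : State) : Prop where
  nat : ∀ x, ¬ N x → s'.nat x = s.nat x
  natArr : s'.natArr = s.natArr
  realArr : s'.realArr = s.realArr
  real : ∀ y, ¬ W y → s'.real y = s.real y

theorem Frame.refl (N W : ℕ → Prop) (s : State) : Frame N W s s :=
  ⟨fun _ _ => rfl, rfl, rfl, fun _ _ => rfl⟩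

theorem Frame.trans {N W N' W' : ℕ → Prop} {s s' s'' : State} (h : Frame N W s s')
    (h' : Frame N' W' s' s'') (hN : ∀ x, N' x → N x) (hW : ∀ x, W' x → W x) : Frame N W s s'' :=
  ⟨fun x hx => (h'.nat x (mt (hN x) hx)).trans (h.nat x hx), h'.natArr.trans h.natArr,
    h'.realArr.trans h.realArr, fun x hx => (h'.real x (mt (hW x) hx)).trans (h.real x hx)⟩

theorem Frame.mono {N W N' W' : ℕ → Prop} {s s' : State} (h : Frame N W s s')
    (hN : ∀ x, N x → N' x) (hW : ∀ x, W x → W' x) : Frame N' W' s s' :=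
  (Frame.refl N' W' s).trans h hN hW

theorem RealFrame.frame {W : ℕ → Prop} {s s' : State} (h : RealFrame W s s') :
    Frame (fun _ => False) W s s' :=
  ⟨fun x _ => congrFun h.nat x, h.natArr, h.realArr, h.real⟩

/-- The frame of subroutines that use scratch registers only. -/
abbrev Scratch : State → State → Prop := Frame (20 ≤ ·) (5 ≤ ·)

/-- Registers and arrays that keep the instance and some constants. -/
structure Env (d : ℕ) {t : ℕ} (l r : Fin t → ℝ[X]) (k : ℕ) (s : State) : Prop where
  nat0 : s.nat 0 = t
  nat1 : s.nat 1 = k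
  nat2 : s.nat 2 = 0
  nat3 : s.nat 3 = 1
  real2 : s.real 2 = 0
  left : ∀ i : Fin t, PolyAt d s 0 i (l i)
  right : ∀ i : Fin t, PolyAt d s (d + 1) i (r i)
  null : PolyAt d s (3 * d + 3) 0 0

theorem PolyAt.congr {d : ℕ} {s s' : State} {B c : ℕ} {p : ℝ[X]} (h : PolyAt d s B c p)
    (hs : s'.realArr = s.realArr) : PolyAt d s' B c p := fun e he => by rw [hs, h e he]

theorem Env.frame {d t k : ℕ} {l r : Fin t → ℝ[X]} {s s' : State} {N W : ℕ → Prop}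
    (h : Env d l r k s) (hf : Frame N W s s') (hN : ∀ x < 4, ¬ N x) (hW : ¬ W 2) :
    Env d l r k s' :=
  ⟨by rw [hf.nat _ (hN _ (by norm_num)), h.nat0], by rw [hf.nat _ (hN _ (by norm_num)), h.nat1],
    by rw [hf.nat _ (hN _ (by norm_num)), h.nat2], by rw [hf.nat _ (hN _ (by norm_num)), h.nat3],
    by rw [hf.real _ hW, h.real2],
    fun i => (h.left i).congr hf.realArr, fun i => (h.right i).congr hf.realArr,
    h.null.congr hf.realArr⟩

/-- Evaluates the endpoints of an interval at the argument in the real register `3`. -/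
def evalEnds (d ix : ℕ) : Prog := evalPoly d 0 ix 3 6 ⨟ evalPoly d (d + 1) ix 3 7

section programs

variable {d t k κ : ℕ} {l r : Fin t → ℝ[X]} {Q : State → ℕ → Prop} {s : State} {T : ℕ}

theorem wp_evalEnds (hl : ∀ i, (l i).natDegree ≤ d) (hr : ∀ i, (r i).natDegree ≤ d) {ix : ℕ}
    (hE : Env d l r k s) (i : Fin t) (hi : s.nat ix = i)
    (h : ∀ s', RealFrame (fun y => y = 6 ∨ y = 7 ∨ 10 ≤ y) s s' →
      s'.real 6 = (l i).eval (s.real 3) → s'.real 7 = (r i).eval (s.real 3) →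
      Q s' (T + (8 * d + 14))) :
    wp d (evalEnds d ix) Q s T := by
  refine wp_seq (wp_evalPoly (by norm_num) (by norm_num) (by norm_num) (by norm_num) hE.nat3
    hE.real2 (by rw [hi]; exact hE.left i) (hl i) fun s₁ hf₁ h₁ => ?_)
  have hE₁ := hE.frame hf₁.frame (by simp) (by norm_num)
  refine wp_evalPoly (by norm_num) (by norm_num) (by norm_num) (by norm_num) hE₁.nat3
    hE₁.real2 (by rw [hf₁.nat, hi]; exact hE₁.right i) (hr i) fun s₂ hf₂ h₂ => ?_
  convert h s₂ ⟨by rw [hf₂.nat, hf₁.nat], by rw [hf₂.natArr, hf₁.natArr],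
    by rw [hf₂.realArr, hf₁.realArr],
    fun y hy => by rw [hf₂.real y (by omega), hf₁.real y (by omega)]⟩ ?_ ?_ using 1
  · omega
  · rw [hf₂.real _ (by norm_num), h₁]
  · rw [h₂, hf₁.real _ (by norm_num)]

/-- Binary search for the number of points, at distances given by the real register `3`, that fit between
the contents of the real registers `5` and `7`. It is added to the natural-number register `21`. -/
def search : Prog :=
  .op (.natAdd 22 4 2) ⨟ .loop (.natLt 2 22)
    (.op (.natSub 23 22 3) ⨟ .op (.realCast 8 23) ⨟ .op (.realMul 8 8 3) ⨟ .op (.realAdd 8 8 5) ⨟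
      .cond (.realLt 7 8) .skip
        (.op (.natAdd 21 21 22) ⨟ .op (.realCast 8 22) ⨟ .op (.realMul 8 8 3) ⨟
          .op (.realAdd 5 5 8)) ⨟
      .op (.natHalf 22 22))

theorem wp_search (h2 : s.nat 2 = 0) (h3 : s.nat 3 = 1) (h4 : s.nat 4 = 2 ^ κ) (hk : k ≤ 2 ^ κ)
    (h : ∀ s' T' (c : ℕ), Frame (fun x => x = 21 ∨ x = 22 ∨ x = 23) (fun y => y = 5 ∨ y = 8) s s' →
      s'.nat 21 = s.nat 21 + c → s'.real 5 = s.real 5 + c * s.real 3 →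
      (c = 0 ∨ s.real 5 + (c - 1) * s.real 3 ≤ s.real 7) →
      (k ≤ c ∨ s.real 7 < s.real 5 + c * s.real 3) → T' ≤ T + (11 * κ + 13) → Q s' T') :
    wp d search Q s T := by
  -- The count is built from its highest binary digit: `c` is what has been accepted, and the true
  -- count is below `c + 2 ^ j` unless it exceeds the cap. The division `2 ^ j / 2` gives 0 at `j =
  -- 0`, which ends the loop; hence the start at `κ + 1`.
  refine wp_op_seq (wp_loop (I := fun s' T' => ∃ c j : ℕ,
    Frame (fun x => x = 21 ∨ x = 22 ∨ x = 23) (fun y => y = 5 ∨ y = 8) s s' ∧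
    s'.nat 22 = 2 ^ j / 2 ∧ s'.nat 21 = s.nat 21 + c ∧ s'.real 5 = s.real 5 + c * s.real 3 ∧
      (c = 0 ∨ s.real 5 + (c - 1) * s.real 3 ≤ s.real 7) ∧
      (k < c + 2 ^ j ∨ s.real 7 < s.real 5 + (c + 2 ^ j - 1) * s.real 3) ∧
      T' + 11 * j ≤ T + (11 * κ + 12)) (fun s' => s'.nat 22)
      ⟨0, κ + 1, ⟨fun x hx => ?_, ?_, ?_, ?_⟩, ?_, ?_, ?_, .inl rfl, .inl ?_, by omega⟩ ?_ ?_)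
  · have : x ≠ 22 := by omega
    simp [Op.step, this]
  · simp [Op.step]
  · simp [Op.step]
  · simp [Op.step]
  · simp [Op.step, h4, h2, pow_succ]
  · simp [Op.step]
  · simp [Op.step]
  · rw [pow_succ]; have := Nat.one_le_two_pow (n := κ); omega
  · rintro s₁ T₁ ⟨c, j, hf, hb, hn, hp, hfit, hmax, hT⟩ hlt
    have hlt' : 0 < s₁.nat 22 := by
      simpa [Test.Holds, hf.nat 2 (by norm_num), h2] using hlt
    obtain ⟨j, rfl⟩ : ∃ j', j = j' + 1 := by
      cases j with
      | zero => simp [hb] at hlt'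
      | succ j => exact ⟨j, rfl⟩
    rw [pow_succ, Nat.mul_div_cancel _ (by norm_num)] at hb
    have e3 := hf.nat 3 (by norm_num)
    have r3 := hf.real 3 (by norm_num)
    have r7 := hf.real 7 (by norm_num)
    have hpow := Nat.one_le_two_pow (n := j)
    refine wp_op_seq (wp_op_seq (wp_op_seq (wp_op_seq (wp_seq ?_))))
    have hcast : ((2 ^ j - 1 : ℕ) : ℝ) = 2 ^ j - 1 := by
      rw [Nat.cast_sub hpow]; push_cast; ring
    refine wp_cond (fun hlt => ?_) (fun hge => ?_)
    · have hlt2 : s.real 7 < s.real 5 + (c + 2 ^ j - 1) * s.real 3 := by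
        simp [Op.step, Test.Holds, e3, h3, hb, r3, r7, hp, hcast] at hlt
        linarith
      refine wp_skip (wp_op ⟨⟨c, j, ⟨fun x hx => ?_, ?_, ?_, fun y hy => ?_⟩, ?_, ?_, ?_, hfit,
        .inr hlt2, by omega⟩, ?_⟩)
      · have := hf.nat x hx
        have e1 : x ≠ 22 := by omega
        have e2 : x ≠ 23 := by omega
        simp [Op.step, e1, e2, this]
      · simp [Op.step, hf.natArr]
      · simp [Op.step, hf.realArr]
      · have := hf.real y hy
        have e1 : y ≠ 8 := by omega
        simp [Op.step, e1, this]
      · simp [Op.step, hb]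
      · simp [Op.step, hn]
      · simp [Op.step, hp]
      · simp [Op.step, hb]; omega
    · have hge2 : s.real 5 + (c + 2 ^ j - 1) * s.real 3 ≤ s.real 7 := by
        simp [Op.step, Test.Holds, e3, h3, hb, r3, r7, hp, hcast] at hge
        linarith
      refine wp_op_seq (wp_op_seq (wp_op_seq (wp_op (wp_op ⟨⟨c + 2 ^ j, j,
        ⟨fun x hx => ?_, ?_, ?_, fun y hy => ?_⟩, ?_, ?_, ?_, .inr ?_, hmax.imp ?_ ?_, by omega⟩,
        ?_⟩))))
      · have := hf.nat x hx
        have e1 : x ≠ 22 := by omega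
        have e2 : x ≠ 23 := by omega
        have e3 : x ≠ 21 := by omega
        simp [Op.step, e1, e2, e3, this]
      · simp [Op.step, hf.natArr]
      · simp [Op.step, hf.realArr]
      · have := hf.real y hy
        have e1 : y ≠ 8 := by omega
        have e2 : y ≠ 5 := by omega
        simp [Op.step, e1, e2, this]
      · simp [Op.step, hb]
      · simp [Op.step, hn, hb]; omega
      · simp [Op.step, hp, hb, r3]; ring
      · push_cast; exact hge2
      · intro h; rw [pow_succ] at h; omega
      · intro h; push_cast; rw [pow_succ] at h; convert h using 3; ring
      · simp [Op.step, hb]; omega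
  · rintro s₁ T₁ ⟨c, j, hf, hb, hn, hp, hfit, hmax, hT⟩ hge
    have hb0 : s₁.nat 22 = 0 := by
      simpa [Test.Holds, hf.nat 2 (by norm_num), h2] using hge
    obtain rfl : j = 0 := by
      cases j with
      | zero => rfl
      | succ j =>
        rw [hb, pow_succ, Nat.mul_div_cancel _ (by norm_num)] at hb0
        have := Nat.one_le_two_pow (n := j)
        omega
    refine h s₁ _ c hf hn hp hfit (hmax.imp (fun h => ?_) fun h => ?_) (by omega)
    · simpa [Nat.lt_succ_iff] using h
    · simpa using h

/-- Greedy placement at the parameter in the real register `3`; the number of points is left in the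
natural-number register `21`. -/
def greedyCount (d : ℕ) : Prog :=
  .op (.natConst 20 0) ⨟ .op (.natConst 21 0) ⨟ .loop (.natLt 20 0)
    (evalEnds d 20 ⨟
      .cond (.realLt 7 6) .skip
        (.cond (.natLt 2 21) (.cond (.realLt 5 6) (.op (.realAdd 5 6 2)) .skip)
          (.op (.realAdd 5 6 2)) ⨟ search) ⨟
      .op (.natAdd 20 20 3))

/-- `Reached` and `Ahead` are maintained together at the fixed parameter. At the end the first
yields a placement if `k` points were reached, and the second excludes one otherwise. -/
theorem wp_greedyCount (hl : ∀ i, (l i).natDegree ≤ d) (hr : ∀ i, (r i).natDegree ≤ d)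
    (hs : SortedDisjoint l r) (hE : Env d l r k s) (h4 : s.nat 4 = 2 ^ κ) (hk0 : 0 < k)
    (hk : k ≤ 2 ^ κ) (hpos : 0 < s.real 3)
    (h : ∀ s' T', Scratch s s' → (s'.nat 21 < k ↔ ¬ Placeable l r k (s.real 3)) →
      T' ≤ T + (3 + t * (8 * d + 11 * κ + 34)) → Q s' T') :
    wp d (greedyCount d) Q s T := by
  set lam := s.real 3 with hlam
  refine wp_op_seq (wp_op_seq (wp_loop (I := fun s' T' => ∃ i : ℕ, i ≤ t ∧
    Scratch s s' ∧ s'.nat 20 = i ∧ Reached l r lam i (s'.nat 21) (s'.real 5) ∧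
      Ahead l r k lam i (s'.nat 21) (s'.real 5) ∧
      T' ≤ T + 2 + i * (8 * d + 11 * κ + 34)) (fun s' => t - s'.nat 20)
      ⟨0, Nat.zero_le _, ⟨fun x hx => ?_, ?_, ?_, ?_⟩, ?_, ?_, ?_, by omega⟩ ?_ ?_))
  · have e1 : x ≠ 20 := by omega
    have e2 : x ≠ 21 := by omega
    simp [Op.step, e1, e2]
  · simp [Op.step]
  · simp [Op.step]
  · simp [Op.step]
  · simp [Op.step]
  · simpa [Op.step] using reached_zero _ _
  · simpa [Op.step] using ahead_zero _
  · rintro s₁ T₁ ⟨i, hi, hf, h20, hre, hah, hT⟩ hlt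
    have hE₁ := hE.frame hf (fun x hx => by omega) (by norm_num)
    have hlt' : i < t := by simpa [Test.Holds, h20, hE₁.nat0] using hlt
    have hr3 : s₁.real 3 = lam := by rw [hf.real _ (by norm_num)]
    refine wp_seq (wp_evalEnds hl hr hE₁ ⟨i, hlt'⟩ h20 fun s₂ hf₂ h6 h7 => wp_seq ?_)
    rw [hr3] at h6 h7
    have hE₂ := hE₁.frame hf₂.frame (by simp) (by norm_num)
    have n21 : s₂.nat 21 = s₁.nat 21 := by rw [hf₂.nat]
    have r5 : s₂.real 5 = s₁.real 5 := hf₂.real _ (by norm_num)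
    have r3 : s₂.real 3 = lam := by rw [hf₂.real _ (by norm_num), hr3]
    have n20 : s₂.nat 20 = i := by rw [hf₂.nat, h20]
    have hfs : Scratch s s₂ := hf.trans hf₂.frame (by simp) (fun y hy => by omega)
    rw [← n21, ← r5] at hre hah
    have hmul : (i + 1) * (8 * d + 11 * κ + 34) =
      i * (8 * d + 11 * κ + 34) + (8 * d + 11 * κ + 34) := by ring
    clear_value lam
    clear hf₂ n21 r5 hE₁ hr3
    refine wp_cond (fun hlt => wp_skip (wp_op ⟨⟨i + 1, hlt', ?_, ?_, ?_, ?_, ?_⟩, ?_⟩)) (fun hge => ?_)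
    · refine hfs.trans (N' := (· = 20)) (W' := fun _ => False) ⟨fun x hx => ?_, rfl, rfl, fun _ _ => rfl⟩
        (fun x hx => by omega) (by simp)
      simp [Op.step, hx]
    · simp [Op.step, n20, hE₂.nat3]
    · simpa [Op.step] using hre.mono (Nat.le_succ i)
    · have : s₂.real 7 < s₂.real 6 := hlt
      rw [h6, h7] at this
      simpa [Op.step] using hah.next (a := ⟨i, hlt'⟩) (.inl this)
    · rw [hmul]; omega
    · simp [Op.step, n20, h20, hE₂.nat3]; omega
    · have hne : (l ⟨i, hlt'⟩).eval lam ≤ (r ⟨i, hlt'⟩).eval lam := by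
        have : ¬ s₂.real 7 < s₂.real 6 := hge
        rwa [h6, h7, not_lt] at this
      -- The common continuation of the three branches that choose the starting position.
      have key : ∀ s₃ T₃, Frame (fun _ => False) (· = 5) s₂ s₃ → T₃ ≤ T₁ + 8 * d + 19 →
          (l ⟨i, hlt'⟩).eval lam ≤ s₃.real 5 → (0 < s₂.nat 21 → s₂.real 5 ≤ s₃.real 5) →
          (s₃.real 5 ≤ (l ⟨i, hlt'⟩).eval lam ∨ 0 < s₂.nat 21 ∧ s₃.real 5 ≤ s₂.real 5) →
          wp d search (wp d (.op (.natAdd 20 20 3)) fun s' T' => (∃ i : ℕ, i ≤ t ∧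
            Scratch s s' ∧ s'.nat 20 = i ∧ Reached l r lam i (s'.nat 21) (s'.real 5) ∧
            Ahead l r k lam i (s'.nat 21) (s'.real 5) ∧
            T' ≤ T + 2 + i * (8 * d + 11 * κ + 34)) ∧ t - s'.nat 20 < t - s₁.nat 20) s₃ T₃ := by
        intro s₃ T₃ hf₃ hT₃ hq hpq hmem
        have hE₃ := hE₂.frame hf₃ (by simp) (by norm_num)
        have hfs₃ : Scratch s s₃ := hfs.trans hf₃ (by simp) (fun y hy => by omega)
        refine wp_search (κ := κ) (k := k) hE₃.nat2 hE₃.nat3 (by rw [hfs₃.nat _ (by norm_num), h4]) hk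
          fun s₄ T₄ c hf₄ c21 c5 cfit cmax hT₄ => ?_
        have k20 : s₄.nat 20 = i := by rw [hf₄.nat _ (by norm_num), hf₃.nat _ (by simp), n20]
        have k3 : s₄.nat 3 = 1 := by rw [hf₄.nat _ (by norm_num), hE₃.nat3]
        rw [hf₃.nat 21 (by simp)] at c21
        rw [hf₃.real 3 (by norm_num), r3] at c5 cfit cmax
        rw [hf₃.real 7 (by norm_num), h7] at cfit cmax
        refine wp_op ⟨⟨i + 1, hlt', ?_, ?_, ?_, ?_, ?_⟩, ?_⟩
        · refine (hfs₃.trans hf₄ (fun x hx => by omega) (fun x hx => by omega)).trans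
            (N' := (· = 20)) (W' := fun _ => False) ⟨fun x hx => ?_, rfl, rfl, fun _ _ => rfl⟩
            (fun x hx => by omega) (by simp)
          simp [Op.step, hx]
        · simp [Op.step, k20, k3]
        · simp only [Op.step, State.nat_setNat, State.real_setNat, c21, c5]
          rcases Nat.eq_zero_or_pos c with rfl | hc
          · have hmono := hre.mono (Nat.le_succ i)
            obtain ⟨x, hx, hp⟩ := hmono
            refine ⟨x, by simpa [c21] using hx, fun hn => ?_⟩
            have hn' : 0 < s₂.nat 21 := by simpa [c21] using hn
            have h1 := hpq hn'
            have h2 : s₃.real 5 ≤ s₂.real 5 := by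
              have hm := cmax.resolve_left (by omega)
              rcases hmem with h | h
              · simp at hm; linarith
              · exact h.2
            have := hp hn'
            simp
            linarith
          · have := hre.step (a := ⟨i, hlt'⟩) hpos (Nat.le_succ i) hq hpq hc
              (cfit.resolve_left hc.ne')
            simpa [c21] using this
        · simp only [Op.step, State.nat_setNat, State.real_setNat, c21, c5]
          have hst := hah.step (a := ⟨i, hlt'⟩) hs hpos hne hmem c
          rcases cmax with hm | hm
          -- If the search reached its cap, at least `k` points are placed and `Ahead` is vacuous.
          · intro y _ hn
            simp at hn
            omega
          · refine hst.next (.inr ⟨?_, hm⟩)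
            rcases hmem with h | h
            · rcases Nat.eq_zero_or_pos c with rfl | hc
              · simp at hm; linarith
              · omega
            · omega
        · rw [hmul]; omega
        · simp [Op.step, k20, h20, k3]; omega
      have hset : Frame (fun _ => False) (· = 5) s₂ (Op.step d s₂ (.realAdd 5 6 2)) :=
        ⟨fun _ _ => rfl, rfl, rfl, fun y hy => by simp [Op.step, hy]⟩
      have hset5 : (Op.step d s₂ (.realAdd 5 6 2)).real 5 = (l ⟨i, hlt'⟩).eval lam := by
        simp [Op.step, h6, hE₂.real2]
      refine wp_seq (wp_cond (fun hn => wp_cond (fun hlt => wp_op ?_) fun hge' => wp_skip ?_)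
        fun hn => wp_op ?_)
      · have : s₂.real 5 < s₂.real 6 := hlt
        rw [h6] at this
        exact key _ _ hset (by omega) hset5.ge (fun _ => hset5 ▸ this.le) (.inl hset5.le)
      · have h1 : ¬ s₂.real 5 < s₂.real 6 := hge'
        rw [h6, not_lt] at h1
        have h2 : s₂.nat 2 < s₂.nat 21 := hn
        exact key _ _ (Frame.refl _ _ _) (by omega) h1 (fun _ => le_rfl)
          (.inr ⟨by omega, le_rfl⟩)
      · have h2 : ¬ s₂.nat 2 < s₂.nat 21 := hn
        rw [hE₂.nat2] at h2
        exact key _ _ hset (by omega) hset5.ge (fun h => absurd h h2) (.inl hset5.le)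
  · rintro s₁ T₁ ⟨i, hi, hf, h20, hre, hah, hT⟩ hge
    have hE₁ := hE.frame hf (fun x hx => by omega) (by norm_num)
    have hit : i = t := by
      have : ¬ i < t := by simpa [Test.Holds, h20, hE₁.nat0] using hge
      omega
    subst hit
    refine h s₁ _ hf ⟨fun hn => hah.not_placeable hn, fun hn => ?_⟩ (by omega)
    by_contra hle
    exact hn (hre.placeable hpos (not_lt.1 hle))

/-- Decides the parameter in the real register `3`. If it is infeasible, it becomes the content of the real
register `1`; otherwise it is recorded in the real register `0` if that is smaller. The natural-number
register `24` tells the two cases apart. -/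
def test (d : ℕ) : Prog :=
  .op (.natConst 24 0) ⨟ .cond (.realLt 2 3)
    (greedyCount d ⨟ .cond (.natLt 21 1)
      (.op (.realAdd 1 3 2) ⨟ .op (.natConst 24 1))
      (.op (.natConst 24 0) ⨟ .cond (.realLt 0 3) (.op (.realAdd 0 3 2)) .skip))
    .skip

theorem wp_test (hl : ∀ i, (l i).natDegree ≤ d) (hr : ∀ i, (r i).natDegree ≤ d)
    (hs : SortedDisjoint l r) (hE : Env d l r k s) (h4 : s.nat 4 = 2 ^ κ) (hk0 : 0 < k)
    (hk : k ≤ 2 ^ κ) {M : ℝ} (hF : feasible l r k = Set.Ioc 0 M) (hlo : 0 ≤ s.real 0)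
    (hloM : s.real 0 ≤ M)
    (h : ∀ s' T', Frame (20 ≤ ·) (fun y => y = 0 ∨ y = 1 ∨ 5 ≤ y) s s' →
      (s'.nat 24 = 1 ∧ M < s.real 3 ∧ s'.real 0 = s.real 0 ∧ s'.real 1 = s.real 3 ∨
        s'.nat 24 = 0 ∧ s.real 3 ≤ M ∧ s'.real 1 = s.real 1 ∧ s.real 0 ≤ s'.real 0 ∧
        s.real 3 ≤ s'.real 0 ∧ s'.real 0 ≤ M) →
      T' ≤ T + (9 + t * (8 * d + 11 * κ + 34)) → Q s' T') :
    wp d (test d) Q s T := by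
  refine wp_op_seq ?_
  set s₁ := Op.step d s (.natConst 24 0) with hs₁
  have hf₁ : Frame (20 ≤ ·) (fun _ => False) s s₁ :=
    ⟨fun x hx => by have : x ≠ 24 := by omega
                    simp [hs₁, Op.step, this], rfl, rfl, fun _ _ => rfl⟩
  have f₁ : s₁.nat 24 = 0 := by simp [hs₁, Op.step]
  have r₁ : s₁.real = s.real := rfl
  have hE₁ := hE.frame hf₁ (fun x hx => by omega) (by norm_num)
  clear_value s₁
  refine wp_cond (fun hpos => wp_seq (wp_greedyCount (κ := κ) hl hr hs hE₁
    (by rw [hf₁.nat _ (by norm_num), h4]) hk0 hk ?_ fun s₂ T₂ hf₂ hcount hT₂ => ?_))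
    fun hneg => wp_skip ?_
  · have : s₁.real 2 < s₁.real 3 := hpos
    rwa [hE₁.real2] at this
  · have hpos : 0 < s.real 3 := by
      have : s₁.real 2 < s₁.real 3 := hpos
      rwa [hE₁.real2, r₁] at this
    have hE₂ := hE₁.frame hf₂ (fun x hx => by omega) (by norm_num)
    have hfs : Frame (20 ≤ ·) (fun y => y = 0 ∨ y = 1 ∨ 5 ≤ y) s s₂ :=
      hf₁.mono (N' := (20 ≤ ·)) (W' := fun y => y = 0 ∨ y = 1 ∨ 5 ≤ y) (fun _ h => h) (by simp)
        |>.trans hf₂ (fun _ h => h) (fun y hy => by omega)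
    have hiff : s.real 3 ≤ M ↔ Placeable l r k (s.real 3) := by
      have : s.real 3 ∈ feasible l r k ↔ s.real 3 ∈ Set.Ioc 0 M := by rw [hF]
      simpa [feasible, hpos] using this.symm
    rw [r₁] at hcount
    have r₂ : ∀ y < 5, s₂.real y = s.real y := fun y hy => by rw [hf₂.real _ (by omega), r₁]
    refine wp_cond (fun hlt => wp_op_seq (wp_op ?_)) fun hge => wp_op_seq ?_
    · have hinf := hcount.1 (by have : s₂.nat 21 < s₂.nat 1 := hlt
                                rwa [hE₂.nat1] at this)
      refine h _ _ ⟨fun x hx => ?_, hfs.natArr, hfs.realArr, fun y hy => ?_⟩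
        (.inl ⟨?_, ?_, ?_, ?_⟩) (by omega)
      · have e : x ≠ 24 := by omega
        simp [Op.step, e, hfs.nat x hx]
      · have e : y ≠ 1 := by omega
        simp [Op.step, e, hfs.real y hy]
      · simp [Op.step]
      · rwa [← hiff, not_le] at hinf
      · simp [Op.step, r₂]
      · simp [Op.step, r₂, hE.real2]
    · have hfe : s.real 3 ≤ M := by
        have : ¬ s₂.nat 21 < s₂.nat 1 := hge
        rw [hE₂.nat1, hcount, not_not] at this
        exact hiff.2 this
      set s₃ := Op.step d s₂ (.natConst 24 0) with hs₃
      have f₃ : s₃.nat 24 = 0 := by simp [hs₃, Op.step]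
      have r₃ : ∀ y < 5, s₃.real y = s.real y := r₂
      have hfs₃ : Frame (20 ≤ ·) (fun y => y = 0 ∨ y = 1 ∨ 5 ≤ y) s s₃ :=
        ⟨fun x hx => by have : x ≠ 24 := by omega
                        simp [hs₃, Op.step, this, hfs.nat x hx], hfs.natArr, hfs.realArr, hfs.real⟩
      clear_value s₃
      refine wp_cond (fun hlt => wp_op ?_) fun hge' => wp_skip ?_
      · have : s₃.real 0 < s₃.real 3 := hlt
        rw [r₃ 0 (by norm_num), r₃ 3 (by norm_num)] at this
        refine h _ _ ⟨fun x hx => ?_, hfs₃.natArr, hfs₃.realArr, fun y hy => ?_⟩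
          (.inr ⟨f₃, hfe, ?_, ?_, ?_, ?_⟩) (by omega)
        · simp [Op.step, hfs₃.nat x hx]
        · have e : y ≠ 0 := by omega
          simp [Op.step, e, hfs₃.real y hy]
        · simp [Op.step, r₃]
        · simp [Op.step, r₃, hE.real2, this.le]
        · simp [Op.step, r₃, hE.real2]
        · simp [Op.step, r₃, hE.real2, hfe]
      · have : ¬ s₃.real 0 < s₃.real 3 := hge'
        rw [r₃ 0 (by norm_num), r₃ 3 (by norm_num), not_lt] at this
        exact h _ _ hfs₃ (.inr ⟨f₃, hfe, r₃ 1 (by norm_num), (r₃ 0 (by norm_num)).ge,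
          this.trans (r₃ 0 (by norm_num)).ge, (r₃ 0 (by norm_num)).trans_le hloM⟩) (by omega)
  -- A nonpositive candidate arises when a threshold polynomial has no positive root. It is below
  -- `M` and needs no greedy run.
  · have hneg' : s.real 3 ≤ 0 := by
      have : ¬ s₁.real 2 < s₁.real 3 := hneg
      rwa [hE₁.real2, r₁, not_lt] at this
    exact h _ _ (hf₁.mono (fun _ h => h) (by simp)) (.inr ⟨f₁, (hneg'.trans hlo).trans hloM, by rw [r₁],
      by rw [r₁], by rw [r₁]; exact hneg'.trans hlo, by rw [r₁]; exact hloM⟩) (by omega)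

end programs

end RealRAM

/-! ### Bracketing the optimum and computing the sizes of the large blocks. -/

namespace RealRAM

open Spacing

section sums

variable {t : ℕ} {α : Type*} [AddCommMonoid α]

/-- The sum of the terms with index less than `i`. -/
def partialSum (f : Fin t → α) (i : ℕ) : α :=
  ∑ j ∈ Finset.univ.filter fun j : Fin t => (j : ℕ) < i, f j

theorem partialSum_zero (f : Fin t → α) : partialSum f 0 = 0 := by simp [partialSum]

theorem partialSum_succ (f : Fin t → α) (i : Fin t) :
    partialSum f (i + 1) = partialSum f i + f i := by
  rw [partialSum, partialSum, add_comm (Finset.sum _ _),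
    ← Finset.sum_insert (a := i) (by simp)]
  congr 1
  ext j
  simp only [Finset.mem_filter, Finset.mem_univ, true_and, Finset.mem_insert, Fin.ext_iff]
  omega

theorem partialSum_top (f : Fin t → α) : partialSum f t = ∑ j, f j := by
  rw [partialSum, Finset.filter_true_of_mem fun j _ => j.2]

end sums

theorem wp_for {d : ℕ} {p : Prog} {Q : State → ℕ → Prop} {s : State} {T x y N : ℕ}
    (I : ℕ → State → ℕ → Prop) (hI : ∀ i s T, I i s T → s.nat x = i ∧ s.nat y = N) (h0 : I 0 s T)
    (hstep : ∀ i < N, ∀ s T, I i s T → wp d p (I (i + 1)) s (T + 1))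
    (hexit : ∀ s T, I N s T → Q s (T + 1)) : wp d (.loop (.natLt x y) p) Q s T := by
  refine wp_loop (I := fun s T => ∃ i ≤ N, I i s T) (fun s => N - s.nat x) ⟨0, Nat.zero_le _, h0⟩ ?_ ?_
  · rintro s T ⟨i, hi, h⟩ hb
    have hx := hI i s T h
    have hlt : i < N := by simpa [Test.Holds, hx] using hb
    refine wp_mono (hstep i hlt s T h) fun s' T' h' => ⟨⟨i + 1, hlt, h'⟩, ?_⟩
    rw [hx.1, (hI _ _ _ h').1]
    omega
  · rintro s T ⟨i, hi, h⟩ hb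
    have hx := hI i s T h
    have hge : ¬ i < N := by simpa [Test.Holds, hx] using hb
    obtain rfl : i = N := by omega
    exact hexit s T h

/-- The hypotheses on an instance with largest feasible parameter `M`. -/
structure Inst (d : ℕ) {t : ℕ} (l r : Fin t → ℝ[X]) (k κ : ℕ) (M : ℝ) : Prop where
  one_le : 1 ≤ d
  left : ∀ i, (l i).natDegree ≤ d
  right : ∀ i, (r i).natDegree ≤ d
  sorted : SortedDisjoint l r
  shrinking : Shrinking l r
  two_le : 2 ≤ k
  le_pow : k ≤ 2 ^ κ
  pos : 0 < M
  feasible : feasible l r k = Set.Ioc 0 M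

/-- The memory during the search for the largest feasible parameter `M`, which is at least the content
of the real register `0` and less than that of the real register `1`. -/
structure Bracket (d : ℕ) {t : ℕ} (l r : Fin t → ℝ[X]) (k κ : ℕ) (M : ℝ) (s : State) : Prop
    extends Env d l r k s where
  nat4 : s.nat 4 = 2 ^ κ
  lo_nonneg : 0 ≤ s.real 0
  lo_le : s.real 0 ≤ M
  lt_hi : M < s.real 1

section programs

variable {d t k κ : ℕ} {l r : Fin t → ℝ[X]} {M : ℝ} {Q : State → ℕ → Prop} {s : State} {T : ℕ}

theorem Bracket.frame {s' : State} {N W : ℕ → Prop} (h : Bracket d l r k κ M s)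
    (hf : Frame N W s s') (hN : ∀ x < 5, ¬ N x) (hW : ∀ y < 3, ¬ W y) : Bracket d l r k κ M s' :=
  ⟨h.toEnv.frame hf (fun x hx => hN x (by omega)) (hW _ (by norm_num)),
    by rw [hf.nat _ (hN _ (by norm_num)), h.nat4], by rw [hf.real _ (hW _ (by norm_num))]; exact h.lo_nonneg,
    by rw [hf.real _ (hW _ (by norm_num))]; exact h.lo_le,
    by rw [hf.real _ (hW _ (by norm_num))]; exact h.lt_hi⟩

/-- Changing natural-number registers and arrays of natural numbers. -/
theorem Bracket.congr {s' : State} (h : Bracket d l r k κ M s) (hn : ∀ x < 5, s'.nat x = s.nat x)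
    (hr : s'.real = s.real) (ha : s'.realArr = s.realArr) : Bracket d l r k κ M s' :=
  h.frame (s' := ⟨s'.nat, s'.real, s.natArr, s'.realArr⟩) (N := (5 ≤ ·)) (W := fun _ => False)
    ⟨fun x hx => hn x (by omega), rfl, ha, fun y _ => by rw [← hr]⟩ (fun x hx => by omega) (by simp)
    |> fun h => ⟨⟨h.nat0, h.nat1, h.nat2, h.nat3, h.real2, h.left, h.right, h.null⟩, h.nat4,
      h.lo_nonneg, h.lo_le, h.lt_hi⟩

theorem wp_test_bracket (hI : Inst d l r k κ M) (hB : Bracket d l r k κ M s) (hle : s.real 3 ≤ s.real 1)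
    (h : ∀ s' T', Frame (20 ≤ ·) (fun y => y = 0 ∨ y = 1 ∨ 5 ≤ y) s s' → Bracket d l r k κ M s' →
      s'.real 1 ≤ s.real 1 → s.real 0 ≤ s'.real 0 →
      (s'.nat 24 = 1 ∧ M < s.real 3 ∧ s'.real 1 = s.real 3 ∨
        s'.nat 24 = 0 ∧ s.real 3 ≤ M ∧ s'.real 1 = s.real 1 ∧ s.real 3 ≤ s'.real 0) →
      T' ≤ T + (9 + t * (8 * d + 11 * κ + 34)) → Q s' T') :
    wp d (test d) Q s T := by
  refine wp_test hI.left hI.right hI.sorted hB.toEnv hB.nat4 (by have := hI.two_le; omega) hI.le_pow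
    hI.feasible hB.lo_nonneg hB.lo_le fun s' T' hf hc hT => ?_
  have hE := hB.toEnv.frame hf (fun x hx => by omega) (by norm_num)
  have h4 : s'.nat 4 = 2 ^ κ := by rw [hf.nat _ (by norm_num), hB.nat4]
  rcases hc with ⟨h24, hM, h0, h1⟩ | ⟨h24, hM, h1, h0, h3, h0M⟩
  · exact h s' T' hf ⟨hE, h4, h0 ▸ hB.lo_nonneg, h0 ▸ hB.lo_le, h1 ▸ hM⟩ (h1.trans_le hle) h0.ge
      (.inl ⟨h24, hM, h1⟩) hT
  · exact h s' T' hf ⟨hE, h4, hB.lo_nonneg.trans h0, h0M, h1 ▸ hB.lt_hi⟩ h1.le h0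
      (.inr ⟨h24, hM, h1, h3⟩) hT

/-- Computes a power of two that is at least the content of the natural-number register `1`. -/
def initPow : Prog := .op (.natConst 3 1) ⨟ .op (.natConst 4 1) ⨟
  .loop (.natLt 4 1) (.op (.natAdd 4 4 4))

theorem wp_initPow (h : ∀ s' T' κ, Frame (fun x => x = 3 ∨ x = 4) (fun _ => False) s s' →
      s'.nat 3 = 1 → s'.nat 4 = 2 ^ κ → s.nat 1 ≤ 2 ^ κ → κ ≤ Nat.clog 2 (s.nat 1) →
      T' ≤ T + (2 * κ + 3) → Q s' T') : wp d initPow Q s T := by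
  refine wp_op_seq (wp_op_seq (wp_loop (I := fun s' T' => ∃ j,
    Frame (fun x => x = 3 ∨ x = 4) (fun _ => False) s s' ∧ s'.nat 3 = 1 ∧ s'.nat 4 = 2 ^ j ∧
      j ≤ Nat.clog 2 (s.nat 1) ∧ T' ≤ T + (2 * j + 2))
      (fun s' => s.nat 1 - s'.nat 4) ⟨0, ⟨fun x hx => ?_, ?_, ?_, ?_⟩, ?_, ?_, Nat.zero_le _, by omega⟩
      ?_ ?_))
  · have e1 : x ≠ 3 := by omega
    have e2 : x ≠ 4 := by omega
    simp [Op.step, e1, e2]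
  · simp [Op.step]
  · simp [Op.step]
  · simp [Op.step]
  · simp [Op.step]
  · simp [Op.step]
  · rintro s₁ T₁ ⟨j, hf, h3, h4, hj, hT⟩ hlt
    have hlt' : 2 ^ j < s.nat 1 := by
      have : s₁.nat 4 < s₁.nat 1 := hlt
      rwa [h4, hf.nat _ (by norm_num)] at this
    have hpow := Nat.one_le_two_pow (n := j)
    refine wp_op ⟨⟨j + 1, ⟨fun x hx => ?_, hf.natArr, hf.realArr, hf.real⟩, ?_, ?_,
      (Nat.lt_clog_iff_pow_lt (by norm_num)).2 hlt', by omega⟩, ?_⟩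
    · have e2 : x ≠ 4 := by omega
      simp [Op.step, e2, hf.nat x hx]
    · simp [Op.step, h3]
    · simp [Op.step, h4, pow_succ, mul_two]
    · simp [Op.step, h4]; omega
  · rintro s₁ T₁ ⟨j, hf, h3, h4, hj, hT⟩ hge
    have hge' : s.nat 1 ≤ 2 ^ j := by
      have : ¬ s₁.nat 4 < s₁.nat 1 := hge
      rwa [h4, hf.nat _ (by norm_num), not_lt] at this
    exact h _ _ j hf h3 h4 hge' hj (by omega)

/-- Computes an infeasible parameter. -/
def initUpper (d : ℕ) : Prog :=
  .op (.realCast 1 3) ⨟ .op (.realCast 3 3) ⨟ .op (.natConst 5 0) ⨟ .loop (.natLt 5 0)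
    (evalEnds d 5 ⨟ .op (.realMul 6 6 6) ⨟ .op (.realMul 7 7 7) ⨟ .op (.realAdd 1 1 6) ⨟
      .op (.realAdd 1 1 7) ⨟ .op (.natAdd 5 5 3))

theorem wp_initUpper (hl : ∀ i, (l i).natDegree ≤ d) (hr : ∀ i, (r i).natDegree ≤ d)
    (hE : Env d l r k s)
    (h : ∀ s' T', Frame (· = 5) (fun y => y = 1 ∨ y = 3 ∨ 5 ≤ y) s s' →
      s'.real 1 = upperBound l r → T' ≤ T + (t * (8 * d + 20) + 4) → Q s' T') :
    wp d (initUpper d) Q s T := by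
  refine wp_op_seq (wp_op_seq (wp_op_seq (wp_for (I := fun i s' T' =>
    (s'.nat 5 = i ∧ s'.nat 0 = t) ∧ Frame (· = 5) (fun y => y = 1 ∨ y = 3 ∨ 5 ≤ y) s s' ∧
      s'.real 3 = 1 ∧ s'.real 1 =
        1 + partialSum (fun i => ((l i).eval 1) ^ 2 + ((r i).eval 1) ^ 2) i ∧
      T' ≤ T + (i * (8 * d + 20) + 3)) (fun i s T h => h.1)
      ⟨⟨?_, ?_⟩, ⟨fun x hx => ?_, rfl, rfl, fun y hy => ?_⟩, ?_, ?_, by omega⟩ ?_ ?_)))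
  · simp [Op.step]
  · simp [Op.step, hE.nat0]
  · simp [Op.step, hx]
  · have e1 : y ≠ 1 := by omega
    have e2 : y ≠ 3 := by omega
    simp [Op.step, e1, e2]
  · simp [Op.step, hE.nat3]
  · simp [Op.step, hE.nat3, partialSum_zero]
  · rintro i hi s₁ T₁ ⟨⟨h5, h0⟩, hf, h3, h1, hT⟩
    have hE₁ := hE.frame hf (fun x hx => by omega) (by norm_num)
    refine wp_seq (wp_evalEnds hl hr hE₁ ⟨i, hi⟩ h5 fun s₂ hf₂ h6 h7 =>
      wp_op_seq (wp_op_seq (wp_op_seq (wp_op_seq (wp_op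
        ⟨⟨?_, ?_⟩, ⟨fun x hx => ?_, ?_, ?_, fun y hy => ?_⟩, ?_, ?_, ?_⟩)))))
    · simp [Op.step, hf₂.nat, h5, hE₁.nat3]
    · simp [Op.step, hf₂.nat, h0]
    · have := hf.nat x hx
      simp [Op.step, hx, hf₂.nat, this]
    · simp [Op.step, hf₂.natArr, hf.natArr]
    · simp [Op.step, hf₂.realArr, hf.realArr]
    · have e1 : y ≠ 1 := by omega
      have e2 : y ≠ 6 := by omega
      have e3 : y ≠ 7 := by omega
      simp [Op.step, e1, e2, e3, hf₂.real y (by omega), hf.real y hy]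
    · simp [Op.step, hf₂.real 3 (by norm_num), h3]
    · have := partialSum_succ (fun i => ((l i).eval 1) ^ 2 + ((r i).eval 1) ^ 2) ⟨i, hi⟩
      simp only at this
      simp [Op.step, hf₂.real 1 (by norm_num), h1, h6, h7, h3, this]
      ring
    · rw [add_mul]; omega
  · rintro s₁ T₁ ⟨-, hf, h3, h1, hT⟩
    refine h _ _ hf ?_ (by omega)
    rw [h1, partialSum_top, upperBound]

/-- Adds to the polynomial in cell `0` of the arrays `2 * d + 2, ...` the length of an interval. -/
def addLength (d ix : ℕ) : ℕ → Prog
  | 0 => .skip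
  | m + 1 => addLength d ix m ⨟ .op (.realLoad 10 (2 * d + 2 + m) 2) ⨟
      .op (.realLoad 11 (d + 1 + m) ix) ⨟ .op (.realAdd 10 10 11) ⨟ .op (.realLoad 11 (0 + m) ix) ⨟
      .op (.realSub 10 10 11) ⨟ .op (.realStore (2 * d + 2 + m) 2 10)

theorem wp_addLength {ix : ℕ} (m : ℕ) (hm : m ≤ d + 1)
    (h : ∀ s', s'.nat = s.nat → s'.natArr = s.natArr → (∀ y < 10, s'.real y = s.real y) →
      (∀ A, (∀ e < m, A ≠ 2 * d + 2 + e) → s'.realArr A = s.realArr A) →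
      (∀ e < m, s'.realArr (2 * d + 2 + e) (s.nat 2) = s.realArr (2 * d + 2 + e) (s.nat 2) +
        s.realArr (d + 1 + e) (s.nat ix) - s.realArr (0 + e) (s.nat ix)) → Q s' (T + (6 * m + 1))) :
    wp d (addLength d ix m) Q s T := by
  induction m generalizing Q with
  | zero => exact wp_skip (h s rfl rfl (fun _ _ => rfl) (fun _ _ => rfl) (by simp))
  | succ m ih =>
    refine wp_seq (ih (by omega) fun s' hn hnA hr hA hS => wp_op_seq (wp_op_seq (wp_op_seq (wp_op_seq
      (wp_op_seq (wp_op ?_))))))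
    have a1 := hA (2 * d + 2 + m) (fun e he => by omega)
    have a2 := hA (d + 1 + m) (fun e he => by omega)
    have a3 := hA (0 + m) (fun e he => by omega)
    convert h _ ?_ ?_ (fun y hy => ?_) (fun A hA' => ?_) (fun e he => ?_) using 1
    · omega
    · simp [Op.step, hn]
    · simp [Op.step, hnA]
    · have e1 : y ≠ 10 := by omega
      have e2 : y ≠ 11 := by omega
      simp [Op.step, e1, e2, hr y hy]
    · have e1 := hA' m (by omega)
      simp [Op.step, e1, hA A fun e he => hA' e (by omega)]
    · rcases Nat.lt_succ_iff_lt_or_eq.1 he with he | rfl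
      · have := hS e he
        have e1 : e ≠ m := he.ne
        simp [Op.step, e1, this]
      · simp only [Op.step, State.realArr_setRealArr, State.nat_setReal, State.real_setReal,
          State.realArr_setReal, hn, a1, a2, a3]
        simp

/-- Collects the intervals that are longer than the parameter for parameters close to the optimum, and
sums up their lengths. -/
def selectLong (d : ℕ) : Prog :=
  .op (.natConst 5 0) ⨟ .loop (.natLt 5 0)
    (.op (.realAdd 3 1 2) ⨟ lower d (d + 1) 5 0 5 3 ⨟ test d ⨟
      .cond (.natLt 2 24) (addLength d 5 (d + 1)) .skip ⨟ .op (.natAdd 5 5 3))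

theorem antitoneOn_sub (h : Shrinking l r) (i j : Fin t) (m : ℕ) :
    AntitoneOn (fun x => (r i).eval x - (l j).eval x - m * x) (Set.Ioi 0) := fun x hx y hy hxy => by
  have h1 := (h i).2 hx hy hxy
  have h2 := (h j).1 hx hy hxy
  have h3 : (m : ℝ) * x ≤ m * y := mul_le_mul_of_nonneg_left hxy (Nat.cast_nonneg m)
  simp only at h1 h2 ⊢
  linarith

/-- Needed for intervals not selected: they are known to be short only at parameters above `M`, and
continuity carries this to `M`. -/
theorem le_of_forall_gt_lt {f : ℝ → ℝ} (hf : Continuous f) {M hi : ℝ} (hM : M < hi)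
    (h : ∀ x, M < x → x ≤ hi → f x < x) : f M ≤ M := by
  by_contra hlt
  have hev := (hf.sub continuous_id).continuousAt.eventually
    (lt_mem_nhds (a := 0) (b := f M - id M) (by simpa using hlt))
  obtain ⟨ε, hε, hball⟩ := Metric.eventually_nhds_iff.1 hev
  have hm : 0 < min (ε / 2) (hi - M) := lt_min (by linarith) (by linarith)
  have h1 := min_le_left (ε / 2) (hi - M)
  have h2 := min_le_right (ε / 2) (hi - M)
  have h3 := hball (y := M + min (ε / 2) (hi - M)) (by rw [Real.dist_eq, abs_of_pos (by linarith)]; linarith)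
  have h4 := h (M + min (ε / 2) (hi - M)) (by linarith) (by linarith)
  simp only [id, Pi.sub_apply] at h3
  linarith

/-- For each interval the threshold of `lam ≤ r i - l i` is decided. An infeasible threshold exceeds
`M`, so the interval is long at `M`; a feasible one is at most `M`, so the interval is short at all
parameters in `(M, hi]`. -/
theorem wp_selectLong (hI : Inst d l r k κ M) (hB : Bracket d l r k κ M s)
    (hS : PolyAt d s (2 * d + 2) 0 0)
    (h : ∀ s' T' (E : Finset (Fin t)), Bracket d l r k κ M s' →
      (∀ i ∈ E, M ≤ (r i).eval M - (l i).eval M) → (∀ i ∉ E, (r i).eval M - (l i).eval M ≤ M) →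
      PolyAt d s' (2 * d + 2) 0 (∑ i ∈ E, (r i - l i)) →
      T' ≤ T + (2 + t * (17 * d + 52 + t * (8 * d + 11 * κ + 34))) → Q s' T') :
    wp d (selectLong d) Q s T := by
  refine wp_op_seq (wp_for (I := fun i s' T' => (s'.nat 5 = i ∧ s'.nat 0 = t) ∧
    Bracket d l r k κ M s' ∧ (∃ E : Finset (Fin t), (∀ j ∈ E, (j : ℕ) < i) ∧
      (∀ j ∈ E, M ≤ (r j).eval M - (l j).eval M) ∧
      (∀ j ∉ E, (j : ℕ) < i → (r j).eval M - (l j).eval M ≤ M) ∧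
      PolyAt d s' (2 * d + 2) 0 (∑ i ∈ E, (r i - l i))) ∧
      T' ≤ T + (1 + i * (17 * d + 52 + t * (8 * d + 11 * κ + 34)))) (fun i s T h => h.1)
      ⟨⟨?_, ?_⟩, ?_, ⟨∅, by simp, by simp, by simp, ?_⟩, by omega⟩ ?_ ?_)
  · simp [Op.step]
  · simp [Op.step, hB.nat0]
  · refine hB.congr (fun x hx => ?_) rfl rfl
    have e : x ≠ 5 := by omega
    simp [Op.step, e]
  · rw [Finset.sum_empty]; exact hS.congr rfl
  · rintro i hi s₁ T₁ ⟨⟨h5, h0⟩, hB₁, ⟨E, hEi, hE, hE', hES⟩, hT⟩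
    have hB₂ : Bracket d l r k κ M (Op.step d s₁ (.realAdd 3 1 2)) :=
      hB₁.frame (N := fun _ => False) (W := (· = 3))
        ⟨fun _ _ => rfl, rfl, rfl, fun y hy => by simp [Op.step, hy]⟩ (by simp) (by intros; omega)
    refine wp_op_seq (wp_seq (wp_lower (p₁ := r ⟨i, hi⟩) (p₂ := l ⟨i, hi⟩) hI.one_le hB₂.nat3 hB₂.real2
      ?_ ?_ (hI.right _) (hI.left _) (antitoneOn_sub hI.shrinking _ _ _) fun s₂ T₂ hf₂ hle hiff hT₂ => ?_))
    · rw [show (Op.step d s₁ (.realAdd 3 1 2)).nat 5 = i from h5]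
      exact hB₂.right ⟨i, hi⟩
    · rw [show (Op.step d s₁ (.realAdd 3 1 2)).nat 5 = i from h5]
      exact hB₂.left ⟨i, hi⟩
    have r1 : (Op.step d s₁ (.realAdd 3 1 2)).real 1 = s₁.real 1 := by simp [Op.step]
    have r3 : (Op.step d s₁ (.realAdd 3 1 2)).real 3 = s₁.real 1 := by simp [Op.step, hB₁.real2]
    rw [r3] at hle hiff
    rw [r1, hB₂.nat3] at hiff
    have q1 : s₂.real 1 = s₁.real 1 := by rw [hf₂.real _ (by norm_num), r1]
    have n₂ : s₂.nat = s₁.nat := hf₂.nat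
    have a₂ : s₂.realArr = s₁.realArr := hf₂.realArr
    have hB₃ := hB₂.frame hf₂.frame (by simp) (by intros; omega)
    clear hf₂ hB₂ r1 r3
    refine wp_seq (wp_test_bracket hI hB₃ (hle.trans q1.ge) fun s₄ T₄ hf₄ hB₄ _ _ hc hT₄ => wp_seq ?_)
    have n5 : s₄.nat 5 = i := by rw [hf₄.nat _ (by norm_num), n₂, h5]
    have hES₄ : PolyAt d s₄ (2 * d + 2) 0 (∑ i ∈ E, (r i - l i)) :=
      hES.congr (by rw [hf₄.realArr, a₂])
    have hmul : (i + 1) * (17 * d + 52 + t * (8 * d + 11 * κ + 34)) =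
      i * (17 * d + 52 + t * (8 * d + 11 * κ + 34)) +
        (17 * d + 52 + t * (8 * d + 11 * κ + 34)) := by ring
    refine wp_cond (fun hlt => wp_addLength _ le_rfl fun s₅ hn hnA hr hA hS₅ => wp_op ?_)
      fun hge => wp_skip (wp_op ?_)
    · have h24 : s₄.nat 2 < s₄.nat 24 := hlt
      rcases hc with ⟨-, hMc, -⟩ | ⟨hc, -⟩
      swap; · omega
      have hroom := ((hiff M hI.pos (hB₁.lt_hi.le)).1 hMc.le).2
      have hB₅ : Bracket d l r k κ M s₅ := by
        refine ⟨⟨by rw [hn, hB₄.nat0], by rw [hn, hB₄.nat1], by rw [hn, hB₄.nat2], by rw [hn, hB₄.nat3],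
          by rw [hr _ (by norm_num), hB₄.real2], fun j e he => ?_, fun j e he => ?_, fun e he => ?_⟩,
          by rw [hn, hB₄.nat4], by rw [hr _ (by norm_num)]; exact hB₄.lo_nonneg,
          by rw [hr _ (by norm_num)]; exact hB₄.lo_le, by rw [hr _ (by norm_num)]; exact hB₄.lt_hi⟩
        · rw [hA _ (fun e' he' => by omega)]; exact hB₄.left j e he
        · rw [hA _ (fun e' he' => by omega)]; exact hB₄.right j e he
        · rw [hA _ (fun e' he' => by omega)]; exact hB₄.null e he
      refine ⟨⟨?_, ?_⟩, hB₅.congr (fun x hx => ?_) rfl rfl, ⟨insert ⟨i, hi⟩ E, ?_, ?_, ?_, ?_⟩, ?_⟩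
      · simp [Op.step, hn, n5, hB₄.nat3]
      · simp [Op.step, hB₅.nat0]
      · have e : x ≠ 5 := by omega
        simp [Op.step, e]
      · intro j hj
        rcases Finset.mem_insert.1 hj with rfl | hj
        · simp
        · have := hEi j hj; omega
      · intro j hj
        rcases Finset.mem_insert.1 hj with rfl | hj
        · push_cast at hroom; linarith
        · exact hE j hj
      · intro j hj hji
        rw [Finset.mem_insert, not_or, Fin.ext_iff] at hj
        have : (j : ℕ) ≠ i := hj.1
        exact hE' j hj.2 (by omega)
      · intro e he
        have h1 := hES₄ e he
        have h2 := hS₅ e (by omega)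
        rw [hB₄.nat2, n5, h1, hB₄.left ⟨i, hi⟩ e he, hB₄.right ⟨i, hi⟩ e he] at h2
        rw [Finset.sum_insert fun hmem => by have := hEi _ hmem; simp at this]
        show s₅.realArr (2 * d + 2 + e) 0 = _
        rw [h2, coeff_add, coeff_sub]
        ring
      · rw [hmul]; omega
    · have h24 : ¬ s₄.nat 2 < s₄.nat 24 := hge
      rw [hB₄.nat2] at h24
      rcases hc with ⟨hc, -⟩ | ⟨-, hcM, -⟩
      · omega
      have hshort : (r ⟨i, hi⟩).eval M - (l ⟨i, hi⟩).eval M ≤ M := by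
        refine le_of_forall_gt_lt (f := fun x => (r ⟨i, hi⟩).eval x - (l ⟨i, hi⟩).eval x) (by fun_prop)
          hB₁.lt_hi fun x hx hxh => ?_
        by_contra hcon
        have := (hiff x (hI.pos.trans hx) hxh).2 ⟨hxh, by push_cast; linarith⟩
        linarith
      refine ⟨⟨?_, ?_⟩, hB₄.congr (fun x hx => ?_) rfl rfl, ⟨E, ?_, hE, ?_, hES₄.congr rfl⟩, ?_⟩
      · simp [Op.step, n5, hB₄.nat3]
      · simp [Op.step, hB₄.nat0]
      · have e : x ≠ 5 := by omega
        simp [Op.step, e]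
      · intro j hj; have := hEi j hj; omega
      · intro j hj hji
        rcases Nat.lt_succ_iff_lt_or_eq.1 hji with hji | hji
        · exact hE' j hj hji
        · rw [show j = ⟨i, hi⟩ from Fin.ext hji]; exact hshort
      · rw [hmul]; omega
  · rintro s₁ T₁ ⟨-, hB₁, ⟨E, -, hE, hE', hES⟩, hT⟩
    exact h _ _ E hB₁ hE (fun i hi => hE' i hi i.2) hES (by omega)

/-- Computes, for every interval, a number of points for which there is room for parameters slightly above
the optimum. -/
def countRoom (d : ℕ) : Prog :=
  .op (.natSub 6 1 0) ⨟ .op (.natSub 6 6 0) ⨟ .op (.realAdd 3 1 2) ⨟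
    lower d (2 * d + 2) 2 (3 * d + 3) 2 6 ⨟ .op (.natConst 5 0) ⨟ .loop (.natLt 5 0)
      (evalEnds d 5 ⨟ .op (.realAdd 5 6 3) ⨟ .op (.realAdd 5 5 3) ⨟ .op (.realAdd 5 5 3) ⨟
        .op (.natConst 21 0) ⨟ search ⨟ .op (.natStore 0 5 21) ⨟ .op (.natAdd 5 5 3))

theorem natDegree_sum_sub_le (hI : Inst d l r k κ M) (E : Finset (Fin t)) :
    (∑ i ∈ E, (r i - l i)).natDegree ≤ d :=
  natDegree_sum_le_of_forall_le _ _ fun i _ =>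
    (natDegree_sub_le _ _).trans (max_le (hI.right i) (hI.left i))

theorem wp_countRoom (hI : Inst d l r k κ M) (hB : Bracket d l r k κ M s) {E : Finset (Fin t)}
    (hE : ∀ i ∈ E, M ≤ (r i).eval M - (l i).eval M)
    (hE' : ∀ i ∉ E, (r i).eval M - (l i).eval M ≤ M)
    (hS : PolyAt d s (2 * d + 2) 0 (∑ i ∈ E, (r i - l i)))
    (h : ∀ s' T' (c : Fin t → ℕ), Bracket d l r k κ M s' → (∀ i : Fin t, s'.natArr 0 i = c i) →
      (∀ i, c i = 0 ∨ ∃ δ, M < δ ∧ ∀ lam, M < lam → lam < δ →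
        ((c i + 1 : ℕ) : ℝ) * lam ≤ (r i).eval lam - (l i).eval lam) →
      (∀ n u, n < k → n = u + ∑ i, c i → u ≤ 5 * t) →
      T' ≤ T + (11 * d + 38 + t * (8 * d + 11 * κ + 34)) → Q s' T') :
    wp d (countRoom d) Q s T := by
  refine wp_op_seq (wp_op_seq (wp_op_seq ?_))
  set s₁ := Op.step d (Op.step d (Op.step d s (.natSub 6 1 0)) (.natSub 6 6 0)) (.realAdd 3 1 2) with hs₁
  have n6 : s₁.nat 6 = k - 2 * t := by
    simp [hs₁, Op.step, hB.nat0, hB.nat1]; omega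
  have r3 : s₁.real 3 = s.real 1 := by simp [hs₁, Op.step, hB.real2]
  have r1 : s₁.real 1 = s.real 1 := by simp [hs₁, Op.step]
  have hB₁ : Bracket d l r k κ M s₁ := by
    refine hB.frame (N := (· = 6)) (W := (· = 3)) ⟨fun x hx => ?_, rfl, rfl, fun y hy => ?_⟩
      (by intros; omega) (by intros; omega)
    · simp [hs₁, Op.step, hx]
    · simp [hs₁, Op.step, hy]
  have hS₁ := hS.congr (s' := s₁) rfl
  clear_value s₁
  have hSe : ∀ x, (∑ i ∈ E, (r i - l i)).eval x = ∑ i ∈ E, ((r i).eval x - (l i).eval x) := fun x => by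
    rw [eval_finsetSum]; simp
  -- The reserved zero polynomial is the subtrahend, and register `2`, which holds 0, is the cell
  -- index of both polynomials.
  refine wp_seq (wp_lower (p₁ := ∑ i ∈ E, (r i - l i)) (p₂ := 0) hI.one_le hB₁.nat3 hB₁.real2
      (by rw [hB₁.nat2]; exact hS₁) (by rw [hB₁.nat2]; exact hB₁.null) (natDegree_sum_sub_le hI E)
      (by simp) ?_ fun s₂ T₂ hf₂ hle hiff hT₂ => wp_op_seq ?_)
  · intro x hx y hy hxy
    have h1 : ∑ i ∈ E, ((r i).eval y - (l i).eval y) ≤ ∑ i ∈ E, ((r i).eval x - (l i).eval x) :=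
      Finset.sum_le_sum fun i _ => by
        have h1 := (hI.shrinking i).2 hx hy hxy
        have h2 := (hI.shrinking i).1 hx hy hxy
        simp only at h1 h2; linarith
    have h3 : (s₁.nat 6 : ℝ) * x ≤ s₁.nat 6 * y := mul_le_mul_of_nonneg_left hxy (Nat.cast_nonneg _)
    simp only [hSe, eval_zero]
    linarith
  rw [r3] at hle hiff
  rw [r1, n6] at hiff
  set β := s₂.real 3 with hβ
  have hB₂ := hB₁.frame hf₂.frame (by simp) (by intros; omega)
  -- By `Chain.mul_le_sum`, a chain of `k` points at `M` forces the selected lengths to sum to at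
  -- least `(k - 2 * t) * M`; if the subtraction truncates, nonnegativity suffices.
  have hMβ : M ≤ β := by
    refine (hiff M hI.pos hB.lt_hi.le).2 ⟨hB.lt_hi.le, ?_⟩
    obtain ⟨y, hy⟩ := Placeable.exists_chain
      (show M ∈ feasible l r k by rw [hI.feasible]; exact ⟨hI.pos, le_rfl⟩).2
    have h1 := hy.mul_le_sum hI.pos E hE hE'
    rw [hSe, eval_zero, zero_add]
    have h2 : 0 ≤ ∑ i ∈ E, ((r i).eval M - (l i).eval M) :=
      Finset.sum_nonneg fun i hi => hI.pos.le.trans (hE i hi)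
    rcases le_total k (2 * t) with hkt | hkt
    · rw [Nat.sub_eq_zero_of_le hkt]; simpa using h2
    · rw [Nat.cast_sub hkt]; push_cast; linarith
  have hβ0 := hI.pos.trans_le hMβ
  have hβS := ((hiff β hβ0 hle).1 le_rfl).2
  rw [hSe, eval_zero, zero_add] at hβS
  clear hf₂ hiff
  refine wp_for (I := fun i s' T' => (s'.nat 5 = i ∧ s'.nat 0 = t) ∧
    Bracket d l r k κ M s' ∧ s'.real 3 = β ∧ (∀ j : Fin t, (j : ℕ) < i →
      (s'.natArr 0 j = 0 ∨ (l j).eval β + 3 * β + (s'.natArr 0 j - 1) * β ≤ (r j).eval β) ∧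
      (k ≤ s'.natArr 0 j ∨ (r j).eval β < (l j).eval β + 3 * β + s'.natArr 0 j * β)) ∧
      T' ≤ T + (11 * d + 36 + i * (8 * d + 11 * κ + 34))) (fun i s T h => h.1)
      ⟨⟨?_, ?_⟩, hB₂.congr (fun x hx => ?_) rfl rfl, rfl, by simp, by omega⟩ ?_ ?_
  · simp [Op.step]
  · simp [Op.step, hB₂.nat0]
  · have e : x ≠ 5 := by omega
    simp [Op.step, e]
  · rintro i hi s₃ T₃ ⟨⟨h5, h0⟩, hB₃, h3, hc, hT⟩
    refine wp_seq (wp_evalEnds hI.left hI.right hB₃.toEnv ⟨i, hi⟩ h5 fun s₄ hf₄ h6 h7 =>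
      wp_op_seq (wp_op_seq (wp_op_seq (wp_op_seq ?_))))
    rw [h3] at h6 h7
    have g3 : s₄.real 3 = β := by rw [hf₄.real _ (by norm_num), h3]
    set s₅ := Op.step d (Op.step d (Op.step d (Op.step d s₄ (.realAdd 5 6 3)) (.realAdd 5 5 3))
      (.realAdd 5 5 3)) (.natConst 21 0) with hs₅
    have k5 : s₅.real 5 = (l ⟨i, hi⟩).eval β + 3 * β := by
      simp [hs₅, Op.step, h6, g3]; ring
    have k3 : s₅.real 3 = β := by simp [hs₅, Op.step, g3]
    have k7 : s₅.real 7 = (r ⟨i, hi⟩).eval β := by simp [hs₅, Op.step, h7]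
    have m21 : s₅.nat 21 = 0 := by simp [hs₅, Op.step]
    have hf₅ : Frame (· = 21) (fun y => 5 ≤ y) s₃ s₅ := by
      refine ⟨fun x hx => ?_, hf₄.natArr, hf₄.realArr, fun y hy => ?_⟩
      · simp [hs₅, Op.step, hx, hf₄.nat]
      · have e : y ≠ 5 := by omega
        simp [hs₅, Op.step, e, hf₄.real y (by omega)]
    have hB₅ := hB₃.frame hf₅ (by intros; omega) (by intros; omega)
    clear_value s₅
    refine wp_seq (wp_search (κ := κ) (k := k) hB₅.nat2 hB₅.nat3 hB₅.nat4 hI.le_pow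
      fun s₆ T₆ c hf₆ c21 c5 cfit cmax hT₆ => wp_op_seq (wp_op ?_))
    rw [k5, k3, k7] at cfit cmax
    rw [m21, zero_add] at c21
    have hB₆ := hB₅.frame hf₆ (by intros; omega) (by intros; omega)
    have j5 : s₆.nat 5 = i := by rw [hf₆.nat _ (by norm_num), hf₅.nat _ (by norm_num), h5]
    have jA : s₆.natArr = s₃.natArr := by rw [hf₆.natArr, hf₅.natArr]
    refine ⟨⟨?_, ?_⟩, hB₆.congr (fun x hx => ?_) rfl rfl, ?_, fun j hj => ?_, ?_⟩
    · simp [Op.step, j5, hB₆.nat3]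
    · simp [Op.step, hB₆.nat0]
    · have e : x ≠ 5 := by omega
      simp [Op.step, e]
    · simp [Op.step, hf₆.real 3 (by norm_num), k3]
    · simp only [Op.step, State.natArr_setNat, State.natArr_setNatArr, if_true, j5, c21, jA]
      rcases Nat.lt_succ_iff_lt_or_eq.1 hj with hj | hj
      · rw [Function.update_of_ne (by omega)]
        exact hc j hj
      · rw [hj, Function.update_self, show j = ⟨i, hi⟩ from Fin.ext hj]
        exact ⟨cfit, cmax⟩
    · rw [add_mul]; omega
  · rintro s₃ T₃ ⟨-, hB₃, -, hc, hT⟩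
    refine h s₃ _ (fun j => s₃.natArr 0 j) hB₃ (fun _ => rfl) (fun j => ?_) (fun n u hn hu => ?_) (by omega)
    · rcases Nat.eq_zero_or_pos (s₃.natArr 0 j) with h0 | h0
      · exact .inl h0
      · exact .inr (exists_room_above hI.shrinking hI.pos hMβ h0 ((hc j j.2).1.resolve_left h0.ne'))
    · exact pushes_le hβ0 hu hn (fun j => (hc j j.2).2) hβS

end programs

end RealRAM

/-! ### The symbolic placement on the machine and its running time. -/

namespace RealRAM

open Spacing

/-- The arrays `1` and `2` of natural numbers hold the list `L`. -/
def ListAt {t : ℕ} (s : State) (L : List (Fin t × ℕ)) : Prop :=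
  ∀ e (h : e < L.length), s.natArr 1 e = (L[e].1 : ℕ) ∧ s.natArr 2 e = L[e].2

/-- The memory during the greedy placement with a symbolic parameter: `n` points have been placed. -/
structure Placing (d : ℕ) {t : ℕ} (l r : Fin t → ℝ[X]) (k κ : ℕ) (M : ℝ) (c : Fin t → ℕ) (n : ℕ)
    (L : List (Fin t × ℕ)) (s : State) : Prop extends Bracket d l r k κ M s where
  nat7 : s.nat 7 = n
  nat8 : s.nat 8 = L.length
  list : ListAt s L
  room : ∀ i : Fin t, s.natArr 0 i = c i

/-- Computes the threshold up to which there is room in an interval for a given number of points. -/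
def fitBound (d : ℕ) : Prog :=
  .op (.natStore 1 8 5) ⨟ .op (.natStore 2 8 7) ⨟ .op (.natAdd 10 7 9) ⨟ .op (.natSub 10 10 3) ⨟
    .op (.realAdd 3 1 2) ⨟ .op (.natConst 11 0) ⨟ .op (.natAdd 12 8 3) ⨟ .loop (.natLt 11 12)
      (.op (.natLoad 13 1 11) ⨟ .op (.natLoad 14 2 11) ⨟ .op (.natSub 14 10 14) ⨟
        lower d (d + 1) 5 0 13 14 ⨟ .op (.natAdd 11 11 3))

/-- Greedy placement with a symbolic parameter. -/
def place (d : ℕ) : Prog :=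
  .op (.natConst 7 0) ⨟ .op (.natConst 8 0) ⨟ .op (.natConst 5 0) ⨟ .loop (.natLt 5 0)
    (.op (.natLoad 9 0 5) ⨟ .op (.natAdd 9 9 3) ⨟
      .loop (.natLt 2 9) (fitBound d ⨟ test d ⨟
        .cond (.natLt 2 24)
          (.op (.natAdd 7 7 9) ⨟ .op (.natAdd 8 8 3) ⨟ .op (.natConst 9 1))
          (.op (.natConst 9 0))) ⨟
      .op (.natAdd 5 5 3))

section programs

variable {d t k κ : ℕ} {l r : Fin t → ℝ[X]} {M : ℝ} {Q : State → ℕ → Prop} {s : State} {T : ℕ}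
  {c : Fin t → ℕ} {n b : ℕ} {L : List (Fin t × ℕ)} {a : Fin t}

/-- A block fits if its last point, of index `n + b - 1`, fits under every record, so the threshold
is a minimum over the records. The tentative record is written behind the list without changing its
stored length, so a failed attempt needs no undoing. -/
theorem wp_fitBound (hI : Inst d l r k κ M) (hP : Placing d l r k κ M c n L s)
    (hL : ∀ x ∈ L, x.2 < n) (h5 : s.nat 5 = a) (h9 : s.nat 9 = b) (hb : 0 < b)
    (h : ∀ s' T', Bracket d l r k κ M s' → (∀ x < 10, s'.nat x = s.nat x) →
      (∀ i : Fin t, s'.natArr 0 i = c i) → ListAt s' (L ++ [(a, n)]) → s'.real 0 = s.real 0 →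
      s'.real 1 = s.real 1 → s'.real 3 ≤ s.real 1 →
      (∀ lam, 0 < lam → lam ≤ s.real 1 → (lam ≤ s'.real 3 ↔ Fits l r L n a b lam)) →
      T' ≤ T + (8 + (L.length + 1) * (11 * d + 37)) → Q s' T') :
    wp d (fitBound d) Q s T := by
  refine wp_op_seq (wp_op_seq (wp_op_seq (wp_op_seq (wp_op_seq (wp_op_seq (wp_op_seq ?_))))))
  set s₁ := Op.step d (Op.step d (Op.step d (Op.step d (Op.step d (Op.step d (Op.step d s
    (.natStore 1 8 5)) (.natStore 2 8 7)) (.natAdd 10 7 9)) (.natSub 10 10 3)) (.realAdd 3 1 2))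
    (.natConst 11 0)) (.natAdd 12 8 3) with hs₁
  have n₁ : ∀ x < 10, s₁.nat x = s.nat x := fun x hx => by
    have e1 : x ≠ 10 := by omega
    have e2 : x ≠ 11 := by omega
    have e3 : x ≠ 12 := by omega
    simp [hs₁, Op.step, e1, e2, e3]
  have n10 : s₁.nat 10 = n + b - 1 := by simp [hs₁, Op.step, hP.nat7, h9, hP.nat3]
  have n11 : s₁.nat 11 = 0 := by simp [hs₁, Op.step]
  have n12 : s₁.nat 12 = (L ++ [(a, n)]).length := by
    simp [hs₁, Op.step, hP.nat8, hP.nat3]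
  have r3 : s₁.real 3 = s.real 1 := by simp [hs₁, Op.step, hP.real2]
  have rr : ∀ y, y ≠ 3 → s₁.real y = s.real y := fun y hy => by simp [hs₁, Op.step, hy]
  have hA : s₁.realArr = s.realArr := rfl
  have hA0 : s₁.natArr 0 = s.natArr 0 := by simp [hs₁, Op.step]
  have hl₁ : ListAt s₁ (L ++ [(a, n)]) := by
    intro e he
    rw [List.length_append, List.length_singleton] at he
    rcases Nat.lt_succ_iff_lt_or_eq.1 he with he | rfl
    · have h1 := hP.list e he
      have h2 : e ≠ s.nat 8 := by rw [hP.nat8]; omega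
      rw [List.getElem_append_left he]
      simp [hs₁, Op.step, h2, h1]
    · simp [hs₁, Op.step, hP.nat8, h5, hP.nat7]
  have hB₁ : Bracket d l r k κ M s₁ :=
    ⟨⟨by rw [n₁ _ (by norm_num), hP.nat0], by rw [n₁ _ (by norm_num), hP.nat1],
      by rw [n₁ _ (by norm_num), hP.nat2], by rw [n₁ _ (by norm_num), hP.nat3],
      by rw [rr _ (by norm_num), hP.real2], fun i => (hP.left i).congr hA,
      fun i => (hP.right i).congr hA, hP.null.congr hA⟩, by rw [n₁ _ (by norm_num), hP.nat4],
      by rw [rr _ (by norm_num)]; exact hP.lo_nonneg, by rw [rr _ (by norm_num)]; exact hP.lo_le,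
      by rw [rr _ (by norm_num)]; exact hP.lt_hi⟩
  clear_value s₁
  set L' := L ++ [(a, n)] with hL'
  -- This makes the truncated subtraction on register `14` exact.
  have hlt : ∀ x ∈ L', x.2 ≤ n + b - 1 := by
    intro x hx
    rcases List.mem_append.1 hx with hx | hx
    · have := hL x hx; omega
    · rw [List.mem_singleton.1 hx]; simp only; omega
  have hlen : L'.length = L.length + 1 := by simp [hL']
  refine wp_for (I := fun i s' T' => (s'.nat 11 = i ∧ s'.nat 12 = L'.length) ∧
    Frame (fun x => x = 11 ∨ x = 13 ∨ x = 14) (fun y => y = 3 ∨ 5 ≤ y) s₁ s' ∧ s'.real 3 ≤ s.real 1 ∧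
      (∀ lam, 0 < lam → lam ≤ s.real 1 → (lam ≤ s'.real 3 ↔ ∀ e (he : e < L'.length), e < i →
        pos l lam (n + b - 1) L'[e] ≤ (r a).eval lam)) ∧
      T' ≤ T + (7 + i * (11 * d + 37))) (fun i s T h => h.1)
      ⟨⟨n11, n12⟩, Frame.refl _ _ _, r3.le, fun lam _ h1 => by simp [r3, h1], by omega⟩ ?_ ?_
  · rintro i hi s₂ T₂ ⟨⟨h11, h12⟩, hf₂, hle, hiff, hT⟩
    refine wp_op_seq (wp_op_seq (wp_op_seq ?_))
    set s₃ := Op.step d (Op.step d (Op.step d s₂ (.natLoad 13 1 11)) (.natLoad 14 2 11))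
      (.natSub 14 10 14) with hs₃
    have hli := hl₁ i hi
    have m13 : s₃.nat 13 = (L'[i].1 : ℕ) := by simp [hs₃, Op.step, h11, hf₂.natArr, hli]
    have m14 : s₃.nat 14 = n + b - 1 - L'[i].2 := by
      simp [hs₃, Op.step, h11, hf₂.natArr, hli, hf₂.nat 10 (by norm_num), n10]
    have hf₃ : Frame (fun x => x = 11 ∨ x = 13 ∨ x = 14) (fun y => y = 3 ∨ 5 ≤ y) s₁ s₃ := by
      refine ⟨fun x hx => ?_, hf₂.natArr, hf₂.realArr, hf₂.real⟩
      have e1 : x ≠ 13 := by omega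
      have e2 : x ≠ 14 := by omega
      simp [hs₃, Op.step, e1, e2, hf₂.nat x hx]
    have m11 : s₃.nat 11 = i := by simp [hs₃, Op.step, h11]
    have m12 : s₃.nat 12 = L'.length := by simp [hs₃, Op.step, h12]
    have rs₃ : s₃.real = s₂.real := rfl
    have hB₃ := hB₁.frame hf₃ (by intros; omega) (by intros; omega)
    have m5 : s₃.nat 5 = a := by rw [hf₃.nat _ (by norm_num), n₁ _ (by norm_num), h5]
    have hr1 : s₃.real 1 = s.real 1 := by rw [hf₃.real _ (by norm_num), rr _ (by norm_num)]
    clear_value s₃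
    refine wp_seq (wp_lower (p₁ := r a) (p₂ := l L'[i].1) hI.one_le hB₃.nat3 hB₃.real2
      (by rw [m5]; exact hB₃.right a) (by rw [m13]; exact hB₃.left _) (hI.right _) (hI.left _)
      (antitoneOn_sub hI.shrinking _ _ _) fun s₄ T₄ hf₄ hle₄ hiff₄ hT₄ => wp_op
        ⟨⟨?_, ?_⟩, ⟨fun x hx => ?_, ?_, ?_, fun y hy => ?_⟩, ?_, fun lam h0 h1 => ?_, ?_⟩)
    · simp [Op.step, hf₄.nat, m11, hB₃.nat3]
    · simp [Op.step, hf₄.nat, m12]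
    · have e1 : x ≠ 11 := by omega
      simp [Op.step, e1, hf₄.nat, hf₃.nat x hx]
    · exact hf₄.natArr.trans hf₃.natArr
    · exact hf₄.realArr.trans hf₃.realArr
    · exact (hf₄.real y hy).trans (hf₃.real y hy)
    · exact (hle₄.trans (by rw [rs₃])).trans hle
    · rw [show (Op.step d s₄ (.natAdd 11 11 3)).real 3 = s₄.real 3 from rfl,
        hiff₄ lam h0 (h1.trans hr1.ge), rs₃, hiff lam h0 h1, m14,
        Nat.cast_sub (hlt _ (List.getElem_mem hi))]
      constructor
      · rintro ⟨h1, h2⟩ e he hei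
        rcases Nat.lt_succ_iff_lt_or_eq.1 hei with hei | rfl
        · exact h1 e he hei
        · exact h2
      · exact fun h => ⟨fun e he hei => h e he (by omega), h i hi (by omega)⟩
    · rw [add_mul]; omega
  · rintro s₂ T₂ ⟨-, hf₂, hle, hiff, hT⟩
    refine h s₂ _ (hB₁.frame hf₂ (by intros; omega) (by intros; omega))
      (fun x hx => (hf₂.nat x (by omega)).trans (n₁ x hx))
      (fun i => by rw [hf₂.natArr, hA0, hP.room]) (fun e he => by rw [hf₂.natArr]; exact hl₁ e he)
      ((hf₂.real 0 (by norm_num)).trans (rr _ (by norm_num)))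
      ((hf₂.real 1 (by norm_num)).trans (rr _ (by norm_num))) hle (fun lam h0 h1 => ?_)
      (by rw [hlen] at hT; omega)
    rw [hiff lam h0 h1, Fits, ← hL']
    constructor
    · intro h x hx
      obtain ⟨e, he, rfl⟩ := List.mem_iff_getElem.1 hx
      exact h e he he
    · exact fun h e he _ => h _ (List.getElem_mem he)

/-- Time for an attempt to place points. -/
def attemptTime (d t κ u : ℕ) : ℕ := (u + 1) * (11 * d + 37) + t * (8 * d + 11 * κ + 34) + 22

theorem attemptTime_mono {u v : ℕ} (h : u ≤ v) : attemptTime d t κ u ≤ attemptTime d t κ v := by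
  unfold attemptTime; gcongr

/-- Every attempt appends a record or closes an interval, so there are at most `L.length + t` of
them. Each record accounts for one point and each `c i` for the surplus of a block, so `n = L.length
+ ∑ c i`, and `hcount` bounds the number of records. -/
theorem wp_place (hI : Inst d l r k κ M) (hB : Bracket d l r k κ M s)
    (hroom : ∀ i : Fin t, s.natArr 0 i = c i)
    (hjump : ∀ i, c i = 0 ∨ ∃ δ, M < δ ∧ ∀ lam, M < lam → lam < δ →
        ((c i + 1 : ℕ) : ℝ) * lam ≤ (r i).eval lam - (l i).eval lam)
    (hcount : ∀ n u, n < k → n = u + ∑ i, c i → u ≤ 5 * t)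
    (h : ∀ s' T', s'.real 0 = M → T' ≤ T + (4 + t * 5 + 6 * t * attemptTime d t κ (5 * t)) → Q s' T') :
    wp d (place d) Q s T := by
  refine wp_op_seq (wp_op_seq (wp_op_seq (wp_for (I := fun i s' T' => (s'.nat 5 = i ∧ s'.nat 0 = t) ∧
    ∃ n L, Placing d l r k κ M c n L s' ∧ Greedy l r k M (s'.real 0) (s'.real 1) i i n L ∧
      n = L.length + partialSum c i ∧
      T' ≤ T + (3 + i * 5 + (L.length + i) * attemptTime d t κ L.length)) (fun i s T h => h.1)
      ⟨⟨?_, ?_⟩, 0, [], ⟨hB.congr (fun x hx => ?_) rfl rfl, ?_, ?_, fun e he => ?_, hroom⟩, Greedy.zero,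
        ?_, ?_⟩ ?_ ?_)))
  · simp [Op.step]
  · simp [Op.step, hB.nat0]
  · have e1 : x ≠ 5 := by omega
    have e2 : x ≠ 7 := by omega
    have e3 : x ≠ 8 := by omega
    simp [Op.step, e1, e2, e3]
  · simp [Op.step]
  · simp [Op.step]
  · simp at he
  · simp [partialSum_zero]
  · simp
  · rintro i hi s₁ T₁ ⟨⟨h5, h0⟩, n₀, L₀, hP₀, hG₀, hn₀, hT₀⟩
    set a : Fin t := ⟨i, hi⟩ with ha
    have hps : partialSum c (i + 1) = partialSum c i + c a := partialSum_succ c a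
    -- Register `9` holds the size of the next block: `c a + 1` at first, 1 after a success, and 0
    -- once the interval is closed.
    refine wp_op_seq (wp_op_seq (wp_seq (wp_loop (I := fun s' T' => s'.nat 5 = i ∧
      ∃ n L, Placing d l r k κ M c n L s' ∧
        ((0 < s'.nat 9 ∧ n + s'.nat 9 = L.length + 1 + partialSum c (i + 1) ∧
          (∃ j ≤ i + 1, Greedy l r k M (s'.real 0) (s'.real 1) j i n L ∧
            (s'.nat 9 = 1 ∨ j = i ∧ s'.nat 9 = c a + 1 ∧ c a ≠ 0)) ∧
          T' ≤ T + (6 + i * 5 + (L.length + i) * attemptTime d t κ L.length)) ∨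
        (s'.nat 9 = 0 ∧ n = L.length + partialSum c (i + 1) ∧
          Greedy l r k M (s'.real 0) (s'.real 1) (i + 1) (i + 1) n L ∧
          T' ≤ T + (6 + i * 5 + (L.length + (i + 1)) * attemptTime d t κ L.length))))
      -- A success raises `n`, which was below `k`; a failure keeps `n` and lowers the second
      -- summand.
      (fun s' => 2 * (k - s'.nat 7) + min (s'.nat 9) 1) ⟨?_, n₀, L₀, ⟨hP₀.toBracket.congr
        (fun x hx => ?_) rfl rfl, ?_, ?_, hP₀.list, hP₀.room⟩, .inl ⟨?_, ?_, ⟨i, by omega, hG₀, ?_⟩, ?_⟩⟩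
        ?_ ?_)))
    · simp [Op.step, h5]
    · have e1 : x ≠ 9 := by omega
      simp [Op.step, e1]
    · simp [Op.step, hP₀.nat7]
    · simp [Op.step, hP₀.nat8]
    · simp [Op.step, hP₀.nat3]
    · have hr := hP₀.room a
      simp [Op.step, hP₀.nat3, h5, ha] at hr ⊢
      rw [hr, hps, hn₀]
      ring
    · have hr := hP₀.room a
      simp [Op.step, hP₀.nat3, h5, ha] at hr ⊢
      rw [hr]
      omega
    · omega
    · rintro s₂ T₂ ⟨g5, n, L, hP, hcase⟩ hlt
      have h9 : 0 < s₂.nat 9 := by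
        have : s₂.nat 2 < s₂.nat 9 := hlt
        rwa [hP.nat2] at this
      rcases hcase with ⟨-, hn, ⟨j, hj, hG, hb⟩, hT⟩ | ⟨h0, -⟩
      swap; · omega
      have hnk := hG.lt_of_feasible hI.pos hI.feasible hP.lt_hi
      refine wp_seq (wp_fitBound hI hP hG.lt (a := a) g5 rfl h9 fun s₃ T₃ hB₃ hn₃ hr₃ hl₃ e0 e1 hle hiff hT₃ =>
        wp_seq (wp_test_bracket hI hB₃ (hle.trans e1.ge) fun s₄ T₄ hf₄ hB₄ _ hlo hc hT₄ => ?_))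
      have hn₄ : ∀ x < 10, s₄.nat x = s₂.nat x := fun x hx => (hf₄.nat x (by omega)).trans (hn₃ x hx)
      have hl₄ : ListAt s₄ (L ++ [(a, n)]) := fun e he => by rw [hf₄.natArr]; exact hl₃ e he
      have hr₄ : ∀ i : Fin t, s₄.natArr 0 i = c i := fun i => by rw [hf₄.natArr, hr₃]
      have hTA : T₄ + 5 ≤ T₂ + 1 + attemptTime d t κ L.length := by
        unfold attemptTime; omega
      have hlo2 : 0 ≤ s₂.real 0 := hP.lo_nonneg
      refine wp_cond (fun hlt => wp_op_seq (wp_op_seq (wp_op ?_))) fun hge => wp_op ?_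
      · have h24 : s₄.nat 2 < s₄.nat 24 := hlt
        rcases hc with ⟨-, hMc, hhi⟩ | ⟨hc, -⟩
        swap; · omega
        have hG' := (hG.mono (lo' := s₄.real 0) le_rfl (e0 ▸ hlo)).push (a := a) hI.sorted hB₄.lo_nonneg
          hj h9 hle hMc hiff
        rw [← hhi] at hG'
        refine ⟨⟨?_, n + s₂.nat 9, L ++ [(a, n)], ⟨hB₄.congr (fun x hx => ?_) rfl rfl, ?_, ?_, hl₄, hr₄⟩,
          .inl ⟨?_, ?_, ⟨i + 1, le_rfl, hG', .inl ?_⟩, ?_⟩⟩, ?_⟩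
        · simp [Op.step, hn₄, g5]
        · have e1 : x ≠ 7 := by omega
          have e2 : x ≠ 8 := by omega
          have e3 : x ≠ 9 := by omega
          simp [Op.step, e1, e2, e3]
        · simp [Op.step, hn₄, hP.nat7]
        · simp [Op.step, hn₄, hP.nat8, hP.nat3]
        · simp [Op.step]
        · simp [Op.step]; omega
        · simp [Op.step]
        · rw [List.length_append, List.length_singleton]
          have h1 := attemptTime_mono (d := d) (t := t) (κ := κ) (Nat.le_succ L.length)
          have h2 : (L.length + i) * attemptTime d t κ L.length + attemptTime d t κ L.length ≤
              (L.length + 1 + i) * attemptTime d t κ (L.length + 1) := by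
            calc _ = (L.length + 1 + i) * attemptTime d t κ L.length := by ring
              _ ≤ _ := Nat.mul_le_mul_left _ h1
          omega
        · simp [Op.step, hn₄, hP.nat7]; omega
      · have h24 : ¬ s₄.nat 2 < s₄.nat 24 := hge
        rw [hB₄.nat2] at h24
        rcases hc with ⟨hc, -⟩ | ⟨-, hcM, hhi, hclo⟩
        · omega
        -- A large block never fails, by `Greedy.lt_of_jump`; so a failure concerns a single point
        -- and the interval is finished.
        have hb1 : s₂.nat 9 = 1 := by
          rcases hb with hb | ⟨rfl, hb, hca⟩
          · exact hb
          · have := Greedy.lt_of_jump (a := a) (b := c a + 1) hG hI.sorted hI.pos hP.lt_hi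
              ((hjump a).resolve_left hca) (Nat.succ_pos _) (by rw [← hb]; exact hiff)
            linarith
        rw [hb1] at hiff hn
        have hG' := (hG.mono (lo' := s₄.real 0) le_rfl (e0 ▸ hlo)).next (a := a) hB₄.lo_nonneg hj hP.lt_hi
          hclo hiff
        rw [← e1, ← hhi] at hG'
        refine ⟨⟨?_, n, L, ⟨hB₄.congr (fun x hx => ?_) rfl rfl, ?_, ?_, fun e he => ?_, hr₄⟩,
          .inr ⟨?_, by omega, hG', ?_⟩⟩, ?_⟩
        · simp [Op.step, hn₄, g5]
        · have e1 : x ≠ 9 := by omega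
          simp [Op.step, e1]
        · simp [Op.step, hn₄, hP.nat7]
        · simp [Op.step, hn₄, hP.nat8]
        · have := hl₄ e (by simp; omega)
          rw [List.getElem_append_left he] at this
          exact this
        · simp [Op.step]
        · have : (L.length + (i + 1)) * attemptTime d t κ L.length =
            (L.length + i) * attemptTime d t κ L.length + attemptTime d t κ L.length := by ring
          omega
        · simp [Op.step, hn₄, hb1]
    · rintro s₂ T₂ ⟨g5, n, L, hP, hcase⟩ hge
      have h9 : ¬ s₂.nat 2 < s₂.nat 9 := hge
      rw [hP.nat2] at h9
      rcases hcase with ⟨h0, -⟩ | ⟨-, hn, hG, hT⟩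
      · omega
      refine wp_op ⟨⟨?_, ?_⟩, n, L, ⟨hP.toBracket.congr (fun x hx => ?_) rfl rfl, ?_, ?_, hP.list, hP.room⟩,
        hG, hn, ?_⟩
      · simp [Op.step, g5, hP.nat3]
      · simp [Op.step, hP.nat0]
      · have e1 : x ≠ 5 := by omega
        simp [Op.step, e1]
      · simp [Op.step, hP.nat7]
      · simp [Op.step, hP.nat8]
      · omega
  · rintro s₁ T₁ ⟨-, n, L, hP, hG, hn, hT⟩
    have hnk := hG.lt_of_feasible hI.pos hI.feasible hP.lt_hi
    rw [partialSum_top] at hn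
    have hu := hcount n L.length hnk hn
    refine h _ _ (hG.eq_of_done hI.pos hI.feasible hP.lo_le hP.lt_hi) ?_
    have : (L.length + t) * attemptTime d t κ L.length ≤ 6 * t * attemptTime d t κ (5 * t) :=
      Nat.mul_le_mul (by omega) (attemptTime_mono hu)
    omega

end programs

/-- The program that computes the largest feasible parameter. -/
def solve (d : ℕ) : Prog := initPow ⨟ initUpper d ⨟ selectLong d ⨟ countRoom d ⨟ place d

theorem input_env {d t k : ℕ} {l r : Fin t → ℝ[X]} {s : State}
    (hf : Frame (fun x => x = 3 ∨ x = 4) (fun _ => False) (input d l r k) s) (h3 : s.nat 3 = 1) :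
    Env d l r k s := by
  refine ⟨?_, ?_, ?_, h3, ?_, fun i e he => ?_, fun i e he => ?_, fun e he => ?_⟩
  · rw [hf.nat _ (by norm_num)]; simp [input]
  · rw [hf.nat _ (by norm_num)]; simp [input]
  · rw [hf.nat _ (by norm_num)]; simp [input]
  · rw [hf.real _ (by simp)]; simp [input]
  · rw [hf.realArr]; simp [input, he]
  · have h1 : ¬ d + 1 + e ≤ d := by omega
    have h2 : d + 1 + e ≤ 2 * d + 1 := by omega
    rw [hf.realArr]; simp only [input, i.2, dif_pos, h1, h2, if_true, if_false]
    simp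
  · have h1 : ¬ 3 * d + 3 + e ≤ d := by omega
    have h2 : ¬ 3 * d + 3 + e ≤ 2 * d + 1 := by omega
    rw [hf.realArr]; simp [input, h1, h2]

/-- Time bound for `solve` in terms of the number of doublings that reach `k`. -/
theorem wp_solve {d t k : ℕ} {l r : Fin t → ℝ[X]} {M : ℝ} (hd : 1 ≤ d) (hk : 2 ≤ k)
    (hl : ∀ i, (l i).natDegree ≤ d) (hr : ∀ i, (r i).natDegree ≤ d) (hs : SortedDisjoint l r)
    (hsh : Shrinking l r) (hM : 0 < M) (hF : feasible l r k = Set.Ioc 0 M) :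
    wp d (solve d) (fun s T => s.real 0 = M ∧
      T ≤ (2000 * d + 2000) * (t ^ 2 * (Nat.clog 2 k + 1) + t * (Nat.clog 2 k + 1) + Nat.clog 2 k + 1))
      (input d l r k) 0 := by
  refine wp_seq (wp_initPow fun s₁ T₁ κ hf₁ h3 h4 hkκ hκ hT₁ => ?_)
  have hE₁ := input_env hf₁ h3
  rw [show (input d l r k).nat 1 = k by simp [input]] at hkκ hκ
  have hI : Inst d l r k κ M := ⟨hd, hl, hr, hs, hsh, hk, hkκ, hM, hF⟩
  refine wp_seq (wp_initUpper hl hr hE₁ fun s₂ T₂ hf₂ h1 hT₂ => ?_)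
  have hB₂ : Bracket d l r k κ M s₂ := by
    have h0 : s₂.real 0 = 0 := by
      rw [hf₂.real _ (by norm_num), hf₁.real _ (by simp)]; simp [input]
    refine ⟨hE₁.frame hf₂ (by intros; omega) (by norm_num), by rw [hf₂.nat _ (by norm_num), h4], h0.ge,
      h0 ▸ hM.le, h1 ▸ lt_upperBound hsh hk ?_⟩
    rw [hF]; exact ⟨hM, le_rfl⟩
  refine wp_seq (wp_selectLong hI hB₂ (fun e he => ?_) fun s₃ T₃ E hB₃ hE hE' hS hT₃ => wp_seq
    (wp_countRoom hI hB₃ hE hE' hS fun s₄ T₄ c hB₄ hc hjump hcount hT₄ =>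
      wp_place hI hB₄ hc hjump hcount fun s₅ T₅ h0 hT₅ => ⟨h0, ?_⟩))
  · have h1 : ¬ 2 * d + 2 + e ≤ d := by omega
    have h2 : ¬ 2 * d + 2 + e ≤ 2 * d + 1 := by omega
    rw [hf₂.realArr, hf₁.realArr]; simp [input, h1, h2]
  · unfold attemptTime at hT₅
    set m := Nat.clog 2 k
    have a1 : t * κ ≤ t * m := Nat.mul_le_mul_left _ hκ
    have a2 : t ^ 2 * κ ≤ t ^ 2 * m := Nat.mul_le_mul_left _ hκ
    have b0 : 0 ≤ d * m := Nat.zero_le _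
    have b1 : 0 ≤ d * (t * m) := Nat.zero_le _
    have b2 : 0 ≤ d * (t ^ 2 * m) := Nat.zero_le _
    have b3 : 0 ≤ d * t := Nat.zero_le _
    have b4 : 0 ≤ d * t ^ 2 := Nat.zero_le _
    have b5 : 0 ≤ t * m := Nat.zero_le _
    have b6 : 0 ≤ t ^ 2 * m := Nat.zero_le _
    have b7 : 0 ≤ t ^ 2 := Nat.zero_le _
    have b8 : 0 ≤ t := Nat.zero_le _
    have b9 : 0 ≤ d := Nat.zero_le _
    have b10 : 0 ≤ m := Nat.zero_le _
    linarith

end RealRAM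

/-! ### From the number of doublings to logarithms. -/

theorem mainTheorem9 (d : ℕ) (hd : 1 ≤ d) :
    ∃ (P : RealRAM.Prog) (C : ℝ), ∀ (t k : ℕ) (l r : Fin t → Polynomial ℝ), 2 ≤ k →
      (∀ i, (l i).natDegree ≤ d) → (∀ i, (r i).natDegree ≤ d) →
      Spacing.SortedDisjoint l r → Spacing.Shrinking l r → (Spacing.feasible l r k).Nonempty →
      ∃ (s : RealRAM.State) (T : ℕ),
        RealRAM.Exec d P (Spacing.input d l r k) s T ∧
        (T : ℝ) ≤ C * ((t : ℝ) ^ 2 * Real.log k +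
          (t : ℝ) * Real.log k * Real.log ((t : ℝ) ^ 2 + k)) ∧
        IsGreatest (Spacing.feasible l r k) (s.real 0) := by
  have hlog2 : 0 < Real.log 2 := Real.log_pos one_lt_two
  refine ⟨RealRAM.solve d, (2000 * d + 2000) * (9 / Real.log 2),
    fun t k l r hk hl hr hs hsh hne => ?_⟩
  obtain ⟨M, hM, hF⟩ := Spacing.exists_feasible_eq hsh hk hne
  obtain ⟨s, T, hexec, h0, hT⟩ := RealRAM.wp_solve hd hk hl hr hs hsh hM hF
  refine ⟨s, T, hexec, ?_, ?_⟩
  · obtain ⟨lam, -, x, hx, -⟩ := hne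
    have ht : 1 ≤ t := by
      obtain ⟨i, -⟩ := hx ⟨0, by omega⟩
      have := i.2
      omega
    have ht' : (1 : ℝ) ≤ t := by exact_mod_cast ht
    have hk' : (2 : ℝ) ≤ k := by exact_mod_cast hk
    have hlogk : Real.log 2 ≤ Real.log k := Real.log_le_log two_pos hk'
    have hclog : (Nat.clog 2 k : ℝ) ≤ Real.log k / Real.log 2 + 1 := by
      have h1 := Nat.pow_pred_clog_lt_self (b := 2) one_lt_two (x := k) (by omega)
      have h2 : ((2 : ℝ) ^ (Nat.clog 2 k).pred) ≤ k := by exact_mod_cast h1.le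
      have h3 := Real.log_le_log (by positivity) h2
      rw [Real.log_pow] at h3
      have h4 : ((Nat.clog 2 k).pred : ℝ) ≤ Real.log k / Real.log 2 := (le_div_iff₀ hlog2).2 h3
      have h5 : (Nat.clog 2 k : ℝ) ≤ (Nat.clog 2 k).pred + 1 := by
        exact_mod_cast Nat.le_succ_of_pred_le le_rfl
      linarith
    have hx1 : 1 ≤ Real.log k / Real.log 2 := (one_le_div hlog2).2 hlogk
    set y := Real.log k / Real.log 2 with hy
    have hlogk' : Real.log k = y * Real.log 2 := by rw [hy]; field_simp
    -- From `Nat.clog 2 k ≤ y + 1` and `1 ≤ y`. Each of the three groups of terms in `hsum` is then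
    -- at most `t ^ 2 * (3 * y)`, whence the 9.
    have hm : (Nat.clog 2 k : ℝ) + 1 ≤ 3 * y := by linarith
    have hm0 : (0 : ℝ) ≤ (Nat.clog 2 k : ℝ) + 1 := by positivity
    have hcast : (T : ℝ) ≤ (2000 * d + 2000) * ((t : ℝ) ^ 2 * (Nat.clog 2 k + 1) +
        t * (Nat.clog 2 k + 1) + Nat.clog 2 k + 1) := by
      have : ((0 + T : ℕ) : ℝ) ≤ _ := Nat.cast_le.2 hT
      push_cast at this
      simpa using this
    have ht2 : (t : ℝ) ≤ t ^ 2 := by nlinarith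
    have hsum : (t : ℝ) ^ 2 * (Nat.clog 2 k + 1) + t * (Nat.clog 2 k + 1) + Nat.clog 2 k + 1 ≤
        (t : ℝ) ^ 2 * (9 * y) := by
      have h1 : (t : ℝ) * (Nat.clog 2 k + 1) ≤ t ^ 2 * (Nat.clog 2 k + 1) :=
        mul_le_mul_of_nonneg_right ht2 hm0
      have h2 : 1 * ((Nat.clog 2 k : ℝ) + 1) ≤ t ^ 2 * (Nat.clog 2 k + 1) :=
        mul_le_mul_of_nonneg_right (ht'.trans ht2) hm0
      have h3 : (t : ℝ) ^ 2 * (Nat.clog 2 k + 1) ≤ t ^ 2 * (3 * y) :=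
        mul_le_mul_of_nonneg_left hm (by positivity)
      linarith
    -- The second summand of the bound only has to be nonnegative: the first alone covers the
    -- running time.
    have hrest : 0 ≤ (t : ℝ) * Real.log k * Real.log ((t : ℝ) ^ 2 + k) :=
      mul_nonneg (mul_nonneg (by positivity) (hlog2.le.trans hlogk))
        (Real.log_nonneg (by nlinarith))
    calc (T : ℝ) ≤ (2000 * d + 2000) * ((t : ℝ) ^ 2 * (9 * y)) :=
          hcast.trans (mul_le_mul_of_nonneg_left hsum (by positivity))
      _ = (2000 * d + 2000) * (9 / Real.log 2) * ((t : ℝ) ^ 2 * Real.log k) := by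
          rw [hlogk']; field_simp
      _ ≤ _ := mul_le_mul_of_nonneg_left (by linarith) (by positivity)
  · rw [h0, hF]
    exact ⟨⟨hM, le_rfl⟩, fun x hx => hx.2⟩
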